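/- Let $(\mathbb{C},\mathcal{J})$ be a small site ($\mathcal{J}$ a Grothendieck topology given by covering sieves) that is subcanonical (every representable presheaf is a sheaf) and in which no object is covered by the empty sieve. Let $\lambda$ be the smallest regular cardinal greater than the number of arrows of every covering sieve. **The theory.** Let $\mathbb{T}=\mathbb{T}^{(\mathbb{C},\mathcal{J})}$ be the following $\lambda$-ary quasi-equational theory. Its sorts are the objects of $\mathbb{C}$. Its function symbols are $\alpha_f : D\to C$ for each morphism $f:C\to D$ of $\mathbb{C}$, and $\sigma_J:\prod_{f\in J}\mathrm{dom}(f)\to C$ for each object $C$ and each $J\in\mathcal{J}(C)$. Write $t\downarrow$ for $t=t$, and $\mathrm{Match}_J(\vec x)$ for $\bigwedge_{f\in J}\bigwedge_{\mathrm{cod}(g)=\mathrm{dom}(f)}\alpha_g(x_f)=x_{f\circ g}$, where $\vec x=(x_f:\mathrm{dom}(f))_{f\in J}$. The axioms are: * $\top\vdash^{x:D}\alpha_f(x)\downarrow$ for $f:C\to D$; $\;\top\vdash^{x:C}\alpha_{\mathrm{id}_C}(x)=x$; $\;\top\vdash^{x:E}\alpha_{g\circ f}(x)=\alpha_f(\alpha_g(x))$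 for $C\xrightarrow{f}D\xrightarrow{g}E$; * for $J\in\mathcal{J}(C)$: $\;\mathrm{Match}_J(\vec x)\vdash^{\vec x}\sigma_J(\vec x)\downarrow\wedge\bigwedge_{f\in J}\alpha_f(\sigma_J(\vec x))=x_f$; * for $J\in\mathcal{J}(C)$: $\;\mathrm{Match}_J(\vec x)\wedge\bigwedge_{f\in J}\alpha_f(y)=x_f\vdash^{\vec x,\,y:C}\sigma_J(\vec x)=y$; * for $J\in\mathcal{J}(C)$: $\;\sigma_J(\vec x)\downarrow\;\vdash^{\vec x}\mathrm{Match}_J(\vec x)$. A sheaf $F$ on $(\mathbb{C},\mathcal{J})$ is regarded as a model of $\mathbb{T}$: the sort $C$ is interpreted by $F(C)$, $\alpha_f$ by $F(f)$, and $\sigma_J$ by the partial function that is defined exactly on the matching families for $J$ and sends each of them to its amalgamation. **Diagram theories.** Provability is that of $\lambda$-ary partial Horn logic (equality is not assumed reflexive except on variables, function symbols are strict, and only defined terms may be substituted for variables). For sorts $(A_i)_{i\in I}$, the signature $\Sigma(F,(\mathsf{x}_i)_{i\in I})$ adds to that of $\mathbb{T}$ a constant $c_a:C$ for each object $C$ and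 each $a\in F(C)$, and pairwise distinct further constants $\mathsf{x}_i:A_i$. The theory $\mathbb{T}(F,(\mathsf{x}_i)_{i\in I})$ adds to $\mathbb{T}$ the axioms $\top\vdash c_a\downarrow$, $\top\vdash\mathsf{x}_i\downarrow$, and $\top\vdash h((c_{a_i})_i)=c_{h^F((a_i)_i)}$ for each function symbol $h$ of $\mathbb{T}$ and each $(a_i)_i\in\mathrm{dom}(h^F)$. For objects $C,B$, let $F\langle\mathsf{x}_C\rangle_B$ be the set of classes $[t]$ of closed terms $t:B$ over $\Sigma(F,\mathsf{x}_C)$ with $\mathbb{T}(F,\mathsf{x}_C)\vdash t\downarrow$, where $[s]=[t]$ iff $\mathbb{T}(F,\mathsf{x}_C)\vdash s=t$. **Logical isotropy group.** $G_{\mathbb{T}}(F)$ consists of all families $([s_C])_C\in\prod_{C\in\mathrm{Ob}(\mathbb{C})}F\langle\mathsf{x}_C\rangle_C$ such that * for every object $C$ there is $[s_C^{-1}]\in F\langle\mathsf{x}_C\rangle_C$ with $\mathbb{T}(F,\mathsf{x}_C)\vdash s_C[s_C^{-1}/\mathsf{x}_C]=\mathsf{x}_C$ and $\mathbb{T}(F,\mathsf{x}_C)\vdash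 s_C^{-1}[s_C/\mathsf{x}_C]=\mathsf{x}_C$; * for every function symbol $h:\prod_{i\in I}A_i\to A$ of $\mathbb{T}$, the theory $\mathbb{T}(F,(\mathsf{x}_i)_{i\in I})$ proves the two sequents $$h((\mathsf{x}_i)_i)\downarrow\;\vdash\; s_A[h((\mathsf{x}_i)_i)/\mathsf{x}_A]=h\big((s_{A_i}[\mathsf{x}_i/\mathsf{x}_{A_i}])_i\big),\qquad h\big((s_{A_i}[\mathsf{x}_i/\mathsf{x}_{A_i}])_i\big)\downarrow\;\vdash\; h((\mathsf{x}_i)_i)\downarrow .$$ **Proposition.** For every sheaf $F$ on $(\mathbb{C},\mathcal{J})$, $$G_{\mathbb{T}}(F)=\Big\{\big([\alpha_{\psi_C}(\mathsf{x}_C)]\big)_{C}\in\prod_{C\in\mathrm{Ob}(\mathbb{C})}F\langle\mathsf{x}_C\rangle_C\;:\;\psi\in\mathrm{Aut}(1_{\mathbb{C}})\Big\},$$ where $\mathrm{Aut}(1_{\mathbb{C}})$ is the group of natural automorphisms of the identity functor of $\mathbb{C}$. -/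

import Mathlib

open CategoryTheory Opposite Cardinal

universe u

namespace PHL

/-! ## Bounded infinitary signatures, terms, Horn formulas -/

/-- A `card`-ary many-sorted signature, where `card` is a regular cardinal.  `Fun A` is the set of
function symbols with output sort `A`; the function symbol `f` has the input sorts
`argSort f i`, for `i` in a set `Arity f` with fewer than `card` elements. -/
structure Signature where
  card : Cardinal.{u}
  regular : card.IsRegular
  Srt : Type u
  Fun : Srt → Type u
  Arity : ∀ {A : Srt}, Fun A → Type u
  arity_lt : ∀ {A : Srt} (f : Fun A), #(Arity f) < card
  argSort : ∀ {A : Srt} (f : Fun A), Arity f → Srt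

/-- A context: a family of fewer than `S.card` sorted variables. -/
structure Ctx (S : Signature.{u}) where
  Var : Type u
  card_lt : #Var < S.card
  sort : Var → S.Srt

/-- `Term S Γ A` is the set of terms of sort `A` with free variables in the context `Γ`. -/
inductive Term (S : Signature.{u}) (Γ : Ctx S) : S.Srt → Type u
  | var (x : Γ.Var) : Term S Γ (Γ.sort x)
  | app {A : S.Srt} (f : S.Fun A) (t : ∀ i : S.Arity f, Term S Γ (S.argSort f i)) : Term S Γ A

/-- Horn formulas with free variables in the context `Γ`. -/
inductive Horn (S : Signature.{u}) (Γ : Ctx S) : Type (u + 1)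
  | eq {A : S.Srt} (s t : Term S Γ A) : Horn S Γ
  | top : Horn S Γ
  | conj (I : Type u) (hI : #I < S.card) (φ : I → Horn S Γ) : Horn S Γ

/-- The Horn sequent `hyp ⊢^ctx concl`. -/
structure Sequent (S : Signature.{u}) where
  ctx : Ctx S
  hyp : Horn S ctx
  concl : Horn S ctx

/-- A quasi-equational theory over `S` is a set of Horn sequents over `S`. -/
abbrev Theory (S : Signature.{u}) := Set (Sequent S)

section Basic

variable {S : Signature.{u}}

theorem Signature.lt_of_finite (S : Signature.{u}) (I : Type u) [Finite I] : #I < S.card :=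
  (Cardinal.lt_aleph0_of_finite I).trans_le S.regular.aleph0_le

/-- The empty context. -/
def Ctx.empty (S : Signature.{u}) : Ctx S where
  Var := PEmpty
  card_lt := S.lt_of_finite _
  sort := fun x => x.elim

/-- The context with one variable of sort `A`. -/
def Ctx.single (A : S.Srt) : Ctx S where
  Var := PUnit
  card_lt := S.lt_of_finite _
  sort := fun _ => A

/-- The context `(x_i)_i` of one variable for each argument of the function symbol `f`. -/
def Ctx.ofArity {A : S.Srt} (f : S.Fun A) : Ctx S where
  Var := S.Arity f
  card_lt := S.arity_lt f
  sort := S.argSort f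

/-- The context `Γ, y` with a further variable `y` of sort `A`. -/
def Ctx.snoc (Γ : Ctx S) (A : S.Srt) : Ctx S where
  Var := Γ.Var ⊕ PUnit.{u + 1}
  card_lt := by
    rw [← Cardinal.add_def]
    exact Cardinal.add_lt_of_lt S.regular.aleph0_le Γ.card_lt (S.lt_of_finite _)
  sort := Sum.elim Γ.sort (fun _ => A)

/-- Closed terms. -/
abbrev ClosedTerm (S : Signature.{u}) (A : S.Srt) := Term S (Ctx.empty S) A

/-- Horn sentences. -/
abbrev Sentence (S : Signature.{u}) := Horn S (Ctx.empty S)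

/-- `t ↓`, i.e. `t = t`. -/
def Horn.defd {Γ : Ctx S} {A : S.Srt} (t : Term S Γ A) : Horn S Γ := .eq t t

/-- Binary conjunction. -/
def Horn.and {Γ : Ctx S} (φ ψ : Horn S Γ) : Horn S Γ :=
  .conj (ULift Bool) (S.lt_of_finite _) (fun b => if b.down then φ else ψ)

/-- Simultaneous substitution of terms for variables. -/
def Term.subst {Γ Δ : Ctx S} (σ : ∀ x : Γ.Var, Term S Δ (Γ.sort x)) :
    ∀ {A : S.Srt}, Term S Γ A → Term S Δ A
  | _, .var x => σ x
  | _, .app f t => .app f (fun i => (t i).subst σ)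

/-- Simultaneous substitution of terms for the variables of a formula. -/
def Horn.subst {Γ Δ : Ctx S} (σ : ∀ x : Γ.Var, Term S Δ (Γ.sort x)) : Horn S Γ → Horn S Δ
  | .eq s t => .eq (s.subst σ) (t.subst σ)
  | .top => .top
  | .conj I hI φ => .conj I hI (fun i => (φ i).subst σ)

/-! ## Deduction in partial Horn logic -/

/-- `Derivable T φ ψ` (for `φ`, `ψ` in a context `Γ`): the sequent `φ ⊢^Γ ψ` is provable in `T`
by the rules of infinitary partial Horn logic.  Every rule has fewer than `S.card` premises. -/
inductive Derivable (T : Theory S) : ∀ {Γ : Ctx S}, Horn S Γ → Horn S Γ → Prop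
  -- axioms of the theory
  | ax {Γ : Ctx S} {φ ψ : Horn S Γ} (h : (⟨Γ, φ, ψ⟩ : Sequent S) ∈ T) : Derivable T φ ψ
  -- identity and cut
  | refl {Γ : Ctx S} (φ : Horn S Γ) : Derivable T φ φ
  | cut {Γ : Ctx S} {φ ψ χ : Horn S Γ} (h₁ : Derivable T φ ψ) (h₂ : Derivable T ψ χ) :
      Derivable T φ χ
  -- substitution of defined terms for variables
  | subst {Γ Δ : Ctx S} {φ ψ : Horn S Γ} (σ : ∀ x : Γ.Var, Term S Δ (Γ.sort x))
      (h : Derivable T φ ψ) :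
      Derivable T ((Horn.conj Γ.Var Γ.card_lt (fun x => Horn.defd (σ x))).and (φ.subst σ))
        (ψ.subst σ)
  -- conjunction
  | top_intro {Γ : Ctx S} (φ : Horn S Γ) : Derivable T φ .top
  | conj_elim {Γ : Ctx S} {I : Type u} (hI : #I < S.card) (φ : I → Horn S Γ) (i : I) :
      Derivable T (.conj I hI φ) (φ i)
  | conj_intro {Γ : Ctx S} {I : Type u} (hI : #I < S.card) {φ : Horn S Γ} {ψ : I → Horn S Γ}
      (h : ∀ i, Derivable T φ (ψ i)) : Derivable T φ (.conj I hI ψ)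
  -- equality is reflexive on variables, and equals may be replaced by equals
  | var_defd {Γ : Ctx S} (x : Γ.Var) : Derivable T .top (.defd (.var x))
  | eq_subst {Γ Δ : Ctx S} (φ : Horn S Γ) (σ τ : ∀ x : Γ.Var, Term S Δ (Γ.sort x)) :
      Derivable T ((Horn.conj Γ.Var Γ.card_lt (fun x => Horn.eq (σ x) (τ x))).and (φ.subst σ))
        (φ.subst τ)
  -- strictness
  | eq_left {Γ : Ctx S} {A : S.Srt} (s t : Term S Γ A) : Derivable T (.eq s t) (.defd s)
  | eq_right {Γ : Ctx S} {A : S.Srt} (s t : Term S Γ A) : Derivable T (.eq s t) (.defd t)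
  | app_strict {Γ : Ctx S} {A : S.Srt} (f : S.Fun A)
      (t : ∀ i : S.Arity f, Term S Γ (S.argSort f i)) (i : S.Arity f) :
      Derivable T (.defd (.app f t)) (.defd (t i))

/-- `T ⊢ φ` for a Horn sentence `φ`. -/
abbrev Theory.Proves (T : Theory S) (φ : Sentence S) : Prop := Derivable T .top φ

theorem Derivable.and_left (T : Theory S) {Γ : Ctx S} (φ ψ : Horn S Γ) :
    Derivable T (φ.and ψ) φ := by
  simpa [Horn.and] using Derivable.conj_elim (T := T) (S.lt_of_finite (ULift Bool))
    (fun b => if b.down then φ else ψ) ⟨true⟩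

theorem Derivable.and_intro {T : Theory S} {Γ : Ctx S} {φ ψ χ : Horn S Γ}
    (h₁ : Derivable T φ ψ) (h₂ : Derivable T φ χ) : Derivable T φ (ψ.and χ) := by
  refine Derivable.conj_intro _ ?_
  rintro ⟨_ | _⟩
  · simpa using h₂
  · simpa using h₁

theorem Derivable.leibniz {T : Theory S} {Γ Δ : Ctx S} {χ : Horn S Δ} (φ : Horn S Γ)
    (σ τ : ∀ x : Γ.Var, Term S Δ (Γ.sort x)) (h : ∀ x, Derivable T χ (.eq (σ x) (τ x)))
    (h' : Derivable T χ (φ.subst σ)) : Derivable T χ (φ.subst τ) :=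
  .cut (.and_intro (.conj_intro _ h) h') (.eq_subst φ σ τ)

theorem Derivable.symm {T : Theory S} {Γ : Ctx S} {φ : Horn S Γ} {A : S.Srt} {s t : Term S Γ A}
    (h : Derivable T φ (.eq s t)) : Derivable T φ (.eq t s) := by
  have hs : Derivable T φ (.eq s s) := h.cut (.eq_left s t)
  let Θ : Ctx S := (Ctx.single A).snoc A
  let σ : ∀ x : Θ.Var, Term S Γ (Θ.sort x) := fun x => match x with
    | .inl _ => s
    | .inr _ => s
  let τ : ∀ x : Θ.Var, Term S Γ (Θ.sort x) := fun x => match x with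
    | .inl _ => t
    | .inr _ => s
  refine Derivable.leibniz (Γ := Θ)
    (.eq (A := A) (.var (Γ := Θ) (.inl ⟨⟩)) (.var (Γ := Θ) (.inr ⟨⟩))) σ τ ?_ hs
  rintro (_ | _)
  · exact h
  · exact hs

theorem Derivable.trans {T : Theory S} {Γ : Ctx S} {φ : Horn S Γ} {A : S.Srt}
    {s t r : Term S Γ A} (h₁ : Derivable T φ (.eq s t)) (h₂ : Derivable T φ (.eq t r)) :
    Derivable T φ (.eq s r) := by
  let Θ : Ctx S := (Ctx.single A).snoc A
  let σ : ∀ x : Θ.Var, Term S Γ (Θ.sort x) := fun x => match x with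
    | .inl _ => s
    | .inr _ => t
  let τ : ∀ x : Θ.Var, Term S Γ (Θ.sort x) := fun x => match x with
    | .inl _ => s
    | .inr _ => r
  refine Derivable.leibniz (Γ := Θ)
    (.eq (A := A) (.var (Γ := Θ) (.inl ⟨⟩)) (.var (Γ := Θ) (.inr ⟨⟩))) σ τ ?_ h₁
  rintro (_ | _)
  · exact h₁.cut (.eq_left s t)
  · exact h₂

/-! ## Partial structures and models -/

/-- A partial `S`-structure: a set for each sort and a partial function for each symbol. -/
structure PartialStructure (S : Signature.{u}) where
  carrier : S.Srt → Type u
  op : ∀ {A : S.Srt} (f : S.Fun A), (∀ i : S.Arity f, carrier (S.argSort f i)) → Part (carrier A)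

/-- The (partial) value of a term at an assignment of elements to the variables. -/
def PartialStructure.eval (M : PartialStructure S) {Γ : Ctx S}
    (a : ∀ x : Γ.Var, M.carrier (Γ.sort x)) : ∀ {A : S.Srt}, Term S Γ A → Part (M.carrier A)
  | _, .var x => Part.some (a x)
  | _, .app f t =>
      Part.bind ⟨∀ i, (M.eval a (t i)).Dom, fun h i => (M.eval a (t i)).get (h i)⟩ (M.op f)

/-- Satisfaction of a Horn formula at an assignment; an equation holds when both sides are
defined and equal. -/
def PartialStructure.Holds (M : PartialStructure S) {Γ : Ctx S}
    (a : ∀ x : Γ.Var, M.carrier (Γ.sort x)) : Horn S Γ → Prop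
  | .eq s t => ∃ b, b ∈ M.eval a s ∧ b ∈ M.eval a t
  | .top => True
  | .conj _ _ φ => ∀ i, M.Holds a (φ i)

theorem mem_eval_app (M : PartialStructure S) {Γ : Ctx S}
    (a : ∀ x : Γ.Var, M.carrier (Γ.sort x)) {A : S.Srt} (f : S.Fun A)
    (t : ∀ i : S.Arity f, Term S Γ (S.argSort f i)) (b : M.carrier A) :
    b ∈ M.eval a (.app f t) ↔ ∃ x : ∀ i, M.carrier (S.argSort f i),
      (∀ i, x i ∈ M.eval a (t i)) ∧ b ∈ M.op f x := by
  rw [PartialStructure.eval, Part.mem_bind_iff]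
  constructor
  · rintro ⟨x, ⟨h, rfl⟩, hb⟩
    exact ⟨_, fun i => Part.get_mem _, hb⟩
  · rintro ⟨x, hx, hb⟩
    exact ⟨x, ⟨fun i => (hx i).1, funext fun i => (hx i).2⟩, hb⟩

theorem holds_and (M : PartialStructure S) {Γ : Ctx S}
    (a : ∀ x : Γ.Var, M.carrier (Γ.sort x)) (φ ψ : Horn S Γ) :
    M.Holds a (φ.and ψ) ↔ M.Holds a φ ∧ M.Holds a ψ := by
  simp [Horn.and, PartialStructure.Holds, and_comm]

/-- `M` satisfies the Horn sequent `q`. -/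
def PartialStructure.Satisfies (M : PartialStructure S) (q : Sequent S) : Prop :=
  ∀ a : (∀ x : q.ctx.Var, M.carrier (q.ctx.sort x)), M.Holds a q.hyp → M.Holds a q.concl

/-- A model of the theory `T`. -/
structure Model (T : Theory S) extends PartialStructure S where
  satisfies : ∀ q ∈ T, toPartialStructure.Satisfies q

/-! ## Adjoining constants -/

/-- The function symbols of `S` together with a new constant of sort `s k` for each `k : K`. -/
inductive AdjoinFun (S : Signature.{u}) {K : Type u} (s : K → S.Srt) : S.Srt → Type u
  | old {A : S.Srt} (f : S.Fun A) : AdjoinFun S s A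
  | const (k : K) : AdjoinFun S s (s k)

/-- The arity of a symbol of the extended signature: the new symbols are constants. -/
def AdjoinFun.Arity {K : Type u} {s : K → S.Srt} : ∀ {A : S.Srt}, AdjoinFun S s A → Type u
  | _, .old f => S.Arity f
  | _, .const _ => PEmpty

/-- The argument sorts of a symbol of the extended signature. -/
def AdjoinFun.argSort {K : Type u} {s : K → S.Srt} :
    ∀ {A : S.Srt} (f : AdjoinFun S s A), f.Arity → S.Srt
  | _, .old f => S.argSort f
  | _, .const _ => fun i => PEmpty.elim i

/-- The signature `S` with a new constant symbol of sort `s k` for each `k : K`. -/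
abbrev Signature.adjoin (S : Signature.{u}) {K : Type u} (s : K → S.Srt) : Signature.{u} where
  card := S.card
  regular := S.regular
  Srt := S.Srt
  Fun := AdjoinFun S s
  Arity := AdjoinFun.Arity
  arity_lt := fun f => match f with
    | .old f => S.arity_lt f
    | .const _ => S.lt_of_finite PEmpty
  argSort := AdjoinFun.argSort

variable {K : Type u} {s : K → S.Srt}

/-- A context over `S`, seen over the extended signature. -/
def Ctx.lift (s : K → S.Srt) (Γ : Ctx S) : Ctx (S.adjoin s) := ⟨Γ.Var, Γ.card_lt, Γ.sort⟩

/-- A term over `S`, seen over the extended signature. -/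
def Term.lift (s : K → S.Srt) {Γ : Ctx S} :
    ∀ {A : S.Srt}, Term S Γ A → Term (S.adjoin s) (Γ.lift s) A
  | _, .var x => Term.var (S := S.adjoin s) (Γ := Γ.lift s) x
  | _, .app f t => Term.app (S := S.adjoin s) (.old f) (fun i => (t i).lift s)

/-- A Horn formula over `S`, seen over the extended signature. -/
def Horn.lift (s : K → S.Srt) {Γ : Ctx S} : Horn S Γ → Horn (S.adjoin s) (Γ.lift s)
  | .eq t₁ t₂ => .eq (t₁.lift s) (t₂.lift s)
  | .top => .top
  | .conj I hI φ => .conj I hI (fun i => (φ i).lift s)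

/-- A Horn sequent over `S`, seen over the extended signature. -/
def Sequent.lift (s : K → S.Srt) (q : Sequent S) : Sequent (S.adjoin s) :=
  ⟨q.ctx.lift s, q.hyp.lift s, q.concl.lift s⟩

/-- The new constant with index `k`, as a closed term. -/
def constTerm (s : K → S.Srt) (k : K) : ClosedTerm (S.adjoin s) (s k) :=
  Term.app (S := S.adjoin s) (.const k) (fun i => PEmpty.elim i)

/-- The application of a symbol of `S` to closed terms over the extended signature. -/
def appOld {A : S.Srt} (f : S.Fun A)
    (t : ∀ i : S.Arity f, ClosedTerm (S.adjoin s) (S.argSort f i)) :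
    ClosedTerm (S.adjoin s) A :=
  Term.app (S := S.adjoin s) (.old f) t

/-- Syntactic substitution: in a closed term over `S` with constants indexed by `K`, replace
every new constant `k` by the closed term `r k` over `S` with constants indexed by `K'`. -/
def substConst {K' : Type u} {s' : K' → S.Srt}
    (r : ∀ k : K, ClosedTerm (S.adjoin s') (s k)) :
    ∀ {A : S.Srt}, ClosedTerm (S.adjoin s) A → ClosedTerm (S.adjoin s') A
  | _, .var x => PEmpty.elim x
  | _, .app (.old f) t => appOld f (fun i => substConst r (t i))
  | _, .app (.const k) _ => r k

/-- The theory `T` together with axioms saying that each new constant is defined. -/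
def Theory.adjoin (T : Theory S) (s : K → S.Srt) : Theory (S.adjoin s) :=
  {q | ∃ q₀ ∈ T, q = q₀.lift s} ∪
  {q | ∃ k : K, q = ⟨Ctx.empty _, .top, .defd (constTerm s k)⟩}

/-! ## The diagram theory of a structure and the free adjunction of indeterminates -/

/-- The index set of the constants `c_a`, for `a` an element of `M` of any sort. -/
abbrev PartialStructure.Elt (M : PartialStructure S) : Type u := (A : S.Srt) × M.carrier A

/-- The sort of the constant `c_a`. -/
abbrev PartialStructure.eltSort (M : PartialStructure S) : M.Elt → S.Srt := Sigma.fst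

/-- The diagram signature `Σ(M)`. -/
abbrev diagramSig (M : PartialStructure S) : Signature.{u} := S.adjoin M.eltSort

/-- The constant `c_a`, as a closed term over `Σ(M)`. -/
def eltTerm (M : PartialStructure S) {A : S.Srt} (a : M.carrier A) :
    ClosedTerm (diagramSig M) A :=
  constTerm M.eltSort ⟨A, a⟩

/-- The diagram theory `T(M)`: the axioms of `T`, the axioms `⊤ ⊢ c_a ↓`, and the axioms
`⊤ ⊢ f (c_{a_i})_i = c_{f^M (a_i)_i}` for every function symbol `f` of `S` and every `(a_i)_i` in
the domain of `f^M`. -/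
def diagramTheory (T : Theory S) (M : PartialStructure S) : Theory (diagramSig M) :=
  T.adjoin M.eltSort ∪
  {q | ∃ (A : S.Srt) (f : S.Fun A) (a : ∀ i : S.Arity f, M.carrier (S.argSort f i))
      (b : M.carrier A), b ∈ M.op f a ∧
      q = ⟨Ctx.empty _, .top, .eq (appOld f (fun i => eltTerm M (a i))) (eltTerm M b)⟩}

/-- The signature `Σ(M, (x_i)_{i ∈ I})` with new constants `x_i` of sort `s i`. -/
abbrev indetSig (M : PartialStructure S) {I : Type u} (s : I → S.Srt) : Signature.{u} :=
  (diagramSig M).adjoin (K := I) s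

/-- The theory `T(M, (x_i)_{i ∈ I})`. -/
def indetTheory (T : Theory S) (M : PartialStructure S) {I : Type u} (s : I → S.Srt) :
    Theory (indetSig M s) :=
  (diagramTheory T M).adjoin (K := I) s

/-- The constant `x_i`, as a closed term over `Σ(M, (x_i)_{i ∈ I})`. -/
def indet (M : PartialStructure S) {I : Type u} (s : I → S.Srt) (i : I) :
    ClosedTerm (indetSig M s) (s i) :=
  constTerm (S := diagramSig M) s i

/-- The application of a symbol of `S` to closed terms over `Σ(M, (x_i)_{i ∈ I})`. -/
def indetApp (M : PartialStructure S) {I : Type u} {s : I → S.Srt} {A : S.Srt} (f : S.Fun A)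
    (t : ∀ i : S.Arity f, ClosedTerm (indetSig M s) (S.argSort f i)) :
    ClosedTerm (indetSig M s) A :=
  appOld (S := diagramSig M) (s := s) (.old f) t

/-- The signature `Σ(M, x_A)`, with one indeterminate of sort `A`. -/
abbrev indetSig₁ (M : PartialStructure S) (A : S.Srt) : Signature.{u} :=
  indetSig M (I := PUnit) (fun _ => A)

/-- The theory `T(M, x_A)`. -/
abbrev indetTheory₁ (T : Theory S) (M : PartialStructure S) (A : S.Srt) :
    Theory (indetSig₁ M A) :=
  indetTheory T M (I := PUnit) (fun _ => A)

/-- The constant `x_A`. -/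
abbrev indet₁ (M : PartialStructure S) (A : S.Srt) : ClosedTerm (indetSig₁ M A) A :=
  indet M (I := PUnit) (fun _ => A) ⟨⟩

/-- The substitution `t[r / x_A]`. -/
def subst₁ (M : PartialStructure S) {A B : S.Srt} {I : Type u} {s : I → S.Srt}
    (t : ClosedTerm (indetSig₁ M A) B) (r : ClosedTerm (indetSig M s) A) :
    ClosedTerm (indetSig M s) B :=
  substConst (S := diagramSig M) (fun _ => r) t

/-- The closed terms `t` of sort `B` over `Σ(M, x_A)` such that `T(M, x_A) ⊢ t ↓`. -/
def DefdTerm (T : Theory S) (M : PartialStructure S) (A B : S.Srt) : Type u :=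
  {t : ClosedTerm (indetSig₁ M A) B // (indetTheory₁ T M A).Proves (.defd t)}

/-- Provable equality in `T(M, x_A)`. -/
def provEq (T : Theory S) (M : PartialStructure S) (A B : S.Srt) : Setoid (DefdTerm T M A B) where
  r t₁ t₂ := (indetTheory₁ T M A).Proves (.eq t₁.1 t₂.1)
  iseqv := ⟨fun t => t.2, fun h => h.symm, fun h h' => h.trans h'⟩

/-- The set `M⟨x_A⟩_B` of classes `[t]` of provably defined closed terms `t` of sort `B` over
`Σ(M, x_A)`, modulo provable equality in `T(M, x_A)`. -/
def FreeExt (T : Theory S) (M : PartialStructure S) (A B : S.Srt) : Type u :=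
  Quotient (provEq T M A B)

/-- The class `[t]`. -/
def FreeExt.mk (T : Theory S) (M : PartialStructure S) {A B : S.Srt} (t : DefdTerm T M A B) :
    FreeExt T M A B :=
  Quotient.mk (provEq T M A B) t

/-! ## The logical isotropy group -/

section Isotropy

variable (T : Theory S) (M : PartialStructure S) (t : ∀ A : S.Srt, ClosedTerm (indetSig₁ M A) A)

/-- `(t_A)_A` commutes generically with `f`: the sequent
`f (x_i)_i ↓ ⊢ t_A[f (x_i)_i / x_A] = f (t_{A_i}[x_i / x_{A_i}])_i` is provable
in `T(M, (x_i)_i)`. -/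
def CommutesGenerically {A : S.Srt} (f : S.Fun A) : Prop :=
  Derivable (indetTheory T M (S.argSort f))
    (.defd (indetApp M f (fun i => indet M (S.argSort f) i)))
    (.eq (subst₁ M (t A) (indetApp M f (fun i => indet M (S.argSort f) i)))
      (indetApp M f (fun i => subst₁ M (t (S.argSort f i)) (indet M (S.argSort f) i))))

/-- `(t_A)_A` reflects definedness of `f`: the sequent
`f (t_{A_i}[x_i / x_{A_i}])_i ↓ ⊢ f (x_i)_i ↓` is provable in `T(M, (x_i)_i)`. -/
def ReflectsDefinedness {A : S.Srt} (f : S.Fun A) : Prop :=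
  Derivable (indetTheory T M (S.argSort f))
    (.defd (indetApp M f (fun i => subst₁ M (t (S.argSort f i)) (indet M (S.argSort f) i))))
    (.defd (indetApp M f (fun i => indet M (S.argSort f) i)))

/-- `(t_A)_A` is substitutionally invertible. -/
def SubstInvertible : Prop :=
  ∀ B : S.Srt, ∃ r : DefdTerm T M B B,
    (indetTheory₁ T M B).Proves (.eq (subst₁ M (t B) r.1) (indet₁ M B)) ∧
    (indetTheory₁ T M B).Proves (.eq (subst₁ M r.1 (t B)) (indet₁ M B))

end Isotropy

/-- (The underlying set of) the logical isotropy group `G_T(M)` of a model `M`: the families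
`([t_A])_A` in the product of the sets `M⟨x_A⟩_A` that are substitutionally invertible and commute
generically with and reflect definedness of every function symbol of `S`. -/
def logicalIsotropy (T : Theory S) (M : Model T) :
    Set (∀ A : S.Srt, FreeExt T M.toPartialStructure A A) :=
  {x | ∃ t : ∀ A : S.Srt, DefdTerm T M.toPartialStructure A A,
    (x = fun A => FreeExt.mk T M.toPartialStructure (t A)) ∧
    SubstInvertible T M.toPartialStructure (fun A => (t A).1) ∧
    (∀ (A : S.Srt) (f : S.Fun A),
      CommutesGenerically T M.toPartialStructure (fun A => (t A).1) f) ∧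
    (∀ (A : S.Srt) (f : S.Fun A),
      ReflectsDefinedness T M.toPartialStructure (fun A => (t A).1) f)}

end Basic

/-! ## The theory of sheaves on a small site -/

noncomputable section Sheaves

variable {C : Type u} [SmallCategory.{u} C] (J : GrothendieckTopology C)

/-- The arrows of a sieve `R` on `X`. -/
abbrev SieveArrow {X : C} (R : Sieve X) : Type u := (Y : C) × {f : Y ⟶ X // R f}

/-- The arrow `g ≫ f` of the sieve `R`, for an arrow `f` of `R`. -/
def SieveArrow.comp {X : C} {R : Sieve X} (f : SieveArrow R) {Z : C} (g : Z ⟶ f.1) :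
    SieveArrow R :=
  ⟨Z, g ≫ f.2.1, R.downward_closed f.2.2 g⟩

/-- The smallest regular cardinal greater than the number of arrows of each covering sieve. -/
def siteCard : Cardinal.{u} :=
  sInf {κ : Cardinal.{u} | κ.IsRegular ∧ ∀ (X : C), ∀ R ∈ J X, #(SieveArrow R) < κ}

theorem siteCard_spec :
    (siteCard J).IsRegular ∧ ∀ (X : C), ∀ R ∈ J X, #(SieveArrow R) < siteCard J := by
  refine csInf_mem (s := {κ : Cardinal.{u} | κ.IsRegular ∧
    ∀ (X : C), ∀ R ∈ J X, #(SieveArrow R) < κ}) ?_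
  refine ⟨Order.succ (max ℵ₀ #((X : C) × (Y : C) × (Y ⟶ X))),
    Cardinal.isRegular_succ (le_max_left _ _), fun X R _ => ?_⟩
  refine Order.lt_succ_of_le (le_trans ?_ (le_max_right _ _))
  refine Cardinal.mk_le_of_injective (f := fun f : SieveArrow R => ⟨X, f.1, f.2.1⟩) ?_
  rintro ⟨Y, f, hf⟩ ⟨Z, g, hg⟩ h
  simp only [Sigma.mk.injEq, heq_eq_eq, true_and] at h
  obtain ⟨rfl, h⟩ := h
  simp only [heq_eq_eq] at h
  subst h
  rfl

theorem arrowsInto_lt (Y : C) : #((Z : C) × (Z ⟶ Y)) < siteCard J := by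
  refine lt_of_le_of_lt ?_ ((siteCard_spec J).2 Y ⊤ (J.top_mem Y))
  refine Cardinal.mk_le_of_injective
    (f := fun g : (Z : C) × (Z ⟶ Y) => (⟨g.1, g.2, trivial⟩ : SieveArrow (⊤ : Sieve Y))) ?_
  rintro ⟨Y, f⟩ ⟨Z, g⟩ h
  simp only [Sigma.mk.injEq] at h
  obtain ⟨rfl, h⟩ := h
  simp only [heq_eq_eq, Subtype.mk.injEq] at h
  subst h
  rfl

/-- The function symbols of the theory of sheaves: `α_f : Y → X` for each `f : X ⟶ Y`, and
`σ_R : ∏_{f ∈ R} dom f → X` for each covering sieve `R` on `X`. -/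
inductive SheafFun : C → Type u
  | alpha {X Y : C} (f : X ⟶ Y) : SheafFun X
  | sigma {X : C} (R : Sieve X) (hR : R ∈ J X) : SheafFun X

/-- The arities of the function symbols of the theory of sheaves. -/
def SheafFun.Arity : ∀ {X : C}, SheafFun J X → Type u
  | _, .alpha _ => PUnit
  | _, .sigma R _ => SieveArrow R

/-- The argument sorts of the function symbols of the theory of sheaves. -/
def SheafFun.argSort : ∀ {X : C} (f : SheafFun J X), f.Arity → C
  | _, .alpha (Y := Y) _ => fun _ => Y
  | _, .sigma _ _ => fun f => f.1

/-- The signature of the theory of sheaves. -/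
abbrev sheafSig : Signature.{u} where
  card := siteCard J
  regular := (siteCard_spec J).1
  Srt := C
  Fun := SheafFun J
  Arity := SheafFun.Arity J
  arity_lt := fun f => match f with
    | .alpha _ => (Cardinal.lt_aleph0_of_finite PUnit).trans_le (siteCard_spec J).1.aleph0_le
    | .sigma R hR => (siteCard_spec J).2 _ R hR
  argSort := SheafFun.argSort J

variable {J} in
/-- The term `α_f(t)`. -/
def alphaApp {Γ : Ctx (sheafSig J)} {X Y : C} (f : X ⟶ Y) (t : Term (sheafSig J) Γ Y) :
    Term (sheafSig J) Γ X :=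
  Term.app (S := sheafSig J) (.alpha f) (fun _ => t)

variable {J} in
/-- The term `σ_R((t_f)_{f ∈ R})`. -/
def sigmaApp {Γ : Ctx (sheafSig J)} {X : C} (R : Sieve X) (hR : R ∈ J X)
    (t : ∀ f : SieveArrow R, Term (sheafSig J) Γ f.1) : Term (sheafSig J) Γ X :=
  Term.app (S := sheafSig J) (.sigma R hR) t

variable {J} in
/-- The formula `⋀_{f ∈ R} ⋀_{cod g = dom f} α_g(t_f) = t_{f ∘ g}`. -/
def matching {Γ : Ctx (sheafSig J)} {X : C} (R : Sieve X) (hR : R ∈ J X)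
    (t : ∀ f : SieveArrow R, Term (sheafSig J) Γ f.1) : Horn (sheafSig J) Γ :=
  .conj (SieveArrow R) ((siteCard_spec J).2 X R hR) fun f =>
    .conj ((Z : C) × (Z ⟶ f.1)) (arrowsInto_lt J f.1) fun g =>
      .eq (alphaApp g.2 (t f)) (t (f.comp g.2))

variable {J} in
/-- The formula `⋀_{f ∈ R} α_f(y) = t_f`. -/
def amalgamates {Γ : Ctx (sheafSig J)} {X : C} (R : Sieve X) (hR : R ∈ J X)
    (t : ∀ f : SieveArrow R, Term (sheafSig J) Γ f.1) (y : Term (sheafSig J) Γ X) :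
    Horn (sheafSig J) Γ :=
  .conj (SieveArrow R) ((siteCard_spec J).2 X R hR) fun f => .eq (alphaApp f.2.1 y) (t f)

/-- The variable `x : X` of the context `x : X`. -/
def theVar (X : C) : Term (sheafSig J) (Ctx.single X) X :=
  Term.var (S := sheafSig J) (Γ := Ctx.single X) PUnit.unit

/-- The context `(x_f : dom f)_{f ∈ R}`. -/
def coverCtx {X : C} (R : Sieve X) (hR : R ∈ J X) : Ctx (sheafSig J) :=
  Ctx.ofArity (S := sheafSig J) (.sigma R hR)

/-- The variable `x_f` of the context `(x_f : dom f)_{f ∈ R}`. -/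
def coverVar {X : C} (R : Sieve X) (hR : R ∈ J X) (f : SieveArrow R) :
    Term (sheafSig J) (coverCtx J R hR) f.1 :=
  Term.var (S := sheafSig J) (Γ := coverCtx J R hR) f

/-- The variable `x_f` of the context `(x_f : dom f)_{f ∈ R}, y : X`. -/
def coverVar' {X : C} (R : Sieve X) (hR : R ∈ J X) (f : SieveArrow R) :
    Term (sheafSig J) ((coverCtx J R hR).snoc X) f.1 :=
  Term.var (S := sheafSig J) (Γ := (coverCtx J R hR).snoc X) (Sum.inl f)

/-- The variable `y` of the context `(x_f : dom f)_{f ∈ R}, y : X`. -/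
def lastVar {X : C} (R : Sieve X) (hR : R ∈ J X) :
    Term (sheafSig J) ((coverCtx J R hR).snoc X) X :=
  Term.var (S := sheafSig J) (Γ := (coverCtx J R hR).snoc X) (Sum.inr PUnit.unit)

/-- The axioms of the theory whose models are the sheaves for `J`. -/
inductive SheafAxiom : Sequent (sheafSig J) → Prop
  | alpha_defd {X Y : C} (f : X ⟶ Y) :
      SheafAxiom ⟨Ctx.single Y, .top, .defd (alphaApp f (theVar J Y))⟩
  | alpha_id (X : C) :
      SheafAxiom ⟨Ctx.single X, .top, .eq (alphaApp (𝟙 X) (theVar J X)) (theVar J X)⟩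
  | alpha_comp {X Y Z : C} (f : X ⟶ Y) (g : Y ⟶ Z) :
      SheafAxiom ⟨Ctx.single Z, .top,
        .eq (alphaApp (f ≫ g) (theVar J Z)) (alphaApp f (alphaApp g (theVar J Z)))⟩
  /-- A matching family has the amalgamation given by `σ_R`. -/
  | exists_amalgamation {X : C} (R : Sieve X) (hR : R ∈ J X) :
      SheafAxiom ⟨coverCtx J R hR, matching R hR (coverVar J R hR),
        (Horn.defd (sigmaApp R hR (coverVar J R hR))).and
          (amalgamates R hR (coverVar J R hR) (sigmaApp R hR (coverVar J R hR)))⟩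
  /-- Any amalgamation of a matching family is the one given by `σ_R`. -/
  | unique_amalgamation {X : C} (R : Sieve X) (hR : R ∈ J X) :
      SheafAxiom ⟨(coverCtx J R hR).snoc X,
        (matching R hR (coverVar' J R hR)).and
          (amalgamates R hR (coverVar' J R hR) (lastVar J R hR)),
        .eq (sigmaApp R hR (coverVar' J R hR)) (lastVar J R hR)⟩
  /-- `σ_R` is defined on matching families only. -/
  | matching_of_defd {X : C} (R : Sieve X) (hR : R ∈ J X) :
      SheafAxiom ⟨coverCtx J R hR, .defd (sigmaApp R hR (coverVar J R hR)),
        matching R hR (coverVar J R hR)⟩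

/-- The quasi-equational theory whose models are the sheaves for `J`. -/
def sheafTheory : Theory (sheafSig J) := {q | SheafAxiom J q}

variable (F : Sheaf J (Type u))

/-- Matching families of elements of `F`, indexed by the arrows of a sieve. -/
def IsMatching {X : C} (R : Sieve X) (x : ∀ f : SieveArrow R, F.obj.obj (op f.1)) : Prop :=
  ∀ (f : SieveArrow R) (Z : C) (g : Z ⟶ f.1), F.obj.map g.op (x f) = x (f.comp g)

variable {J F} in
theorem exists_unique_amalgamation {X : C} (R : Sieve X) (hR : R ∈ J X)
    {x : ∀ f : SieveArrow R, F.obj.obj (op f.1)} (hx : IsMatching J F R x) :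
    ∃! y : F.obj.obj (op X), ∀ f : SieveArrow R, F.obj.map f.2.1.op y = x f := by
  have hF : Presieve.IsSheaf J F.obj := (isSheaf_iff_isSheaf_of_type J F.obj).1 F.property
  let fam : Presieve.FamilyOfElements F.obj R.arrows := fun Y f hf => x ⟨Y, f, hf⟩
  have hc : fam.Compatible := by
    refine (Presieve.compatible_iff_sieveCompatible fam).2 ?_
    intro Y Z f g hf
    exact (hx ⟨Y, f, hf⟩ Z g).symm
  obtain ⟨y, hy, hu⟩ := hF R hR _ hc
  exact ⟨y, fun f => hy f.2.1 f.2.2, fun z hz => hu z fun Y f hf => hz ⟨Y, f, hf⟩⟩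

/-- The operations of a sheaf `F` as a partial structure. -/
def sheafOp : ∀ {X : C} (f : SheafFun J X),
    (∀ i : f.Arity, F.obj.obj (op (SheafFun.argSort J f i))) → Part (F.obj.obj (op X))
  | _, .alpha f => fun x => Part.some (F.obj.map f.op (x PUnit.unit))
  | _, .sigma R hR => fun x =>
      ⟨IsMatching J F R x, fun hx => (exists_unique_amalgamation R hR hx).choose⟩

/-- The sheaf `F` as a partial structure: `α_f` is `F(f)`, and `σ_R` sends a matching family to
its unique amalgamation. -/
def sheafStructure : PartialStructure (sheafSig J) where
  carrier X := F.obj.obj (op X)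
  op f := sheafOp J F f

theorem mem_eval_alpha {Γ : Ctx (sheafSig J)}
    (a : ∀ x : Γ.Var, (sheafStructure J F).carrier (Γ.sort x)) {X Y : C} (f : X ⟶ Y)
    (t : Term (sheafSig J) Γ Y) (b : F.obj.obj (op X)) :
    b ∈ (sheafStructure J F).eval a (alphaApp f t) ↔
      ∃ c : F.obj.obj (op Y), c ∈ (sheafStructure J F).eval a t ∧ b = F.obj.map f.op c := by
  refine (mem_eval_app _ a _ _ b).trans ?_
  constructor
  · rintro ⟨x, hx, hb⟩
    exact ⟨x PUnit.unit, hx PUnit.unit, Part.mem_some_iff.1 hb⟩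
  · rintro ⟨c, hc, hb⟩
    exact ⟨fun _ => c, fun _ => hc, Part.mem_some_iff.2 hb⟩

theorem mem_eval_sigma {Γ : Ctx (sheafSig J)}
    (a : ∀ x : Γ.Var, (sheafStructure J F).carrier (Γ.sort x)) {X : C} (R : Sieve X)
    (hR : R ∈ J X) (t : ∀ f : SieveArrow R, Term (sheafSig J) Γ f.1) (b : F.obj.obj (op X)) :
    b ∈ (sheafStructure J F).eval a (sigmaApp R hR t) ↔
      ∃ x : ∀ f : SieveArrow R, F.obj.obj (op f.1),
        (∀ f, x f ∈ (sheafStructure J F).eval a (t f)) ∧ IsMatching J F R x ∧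
        ∀ f : SieveArrow R, F.obj.map f.2.1.op b = x f := by
  refine (mem_eval_app _ a _ _ b).trans ?_
  constructor
  · rintro ⟨x, hx, hm, rfl⟩
    exact ⟨x, hx, hm, (exists_unique_amalgamation R hR hm).choose_spec.1⟩
  · rintro ⟨x, hx, hm, hb⟩
    exact ⟨x, hx, hm, ((exists_unique_amalgamation R hR hm).choose_spec.2 b hb).symm⟩

theorem holds_matching {Γ : Ctx (sheafSig J)}
    (a : ∀ x : Γ.Var, (sheafStructure J F).carrier (Γ.sort x)) {X : C} (R : Sieve X)
    (hR : R ∈ J X) (t : ∀ f : SieveArrow R, Term (sheafSig J) Γ f.1)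
    (x : ∀ f : SieveArrow R, F.obj.obj (op f.1))
    (hx : ∀ f, x f ∈ (sheafStructure J F).eval a (t f)) :
    (sheafStructure J F).Holds a (matching R hR t) ↔ IsMatching J F R x := by
  constructor
  · intro h f Z g
    obtain ⟨b, hb, hb'⟩ := h f ⟨Z, g⟩
    obtain ⟨c, hc, rfl⟩ := (mem_eval_alpha J F a g (t f) b).1 hb
    have h₁ := Part.mem_unique hc (hx f)
    subst h₁
    exact Part.mem_unique hb' (hx (f.comp g))
  · intro h f g
    refine ⟨x (f.comp g.2), (mem_eval_alpha J F a g.2 (t f) _).2 ⟨x f, hx f, ?_⟩,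
      hx (f.comp g.2)⟩
    exact (h f g.1 g.2).symm

theorem holds_amalgamates {Γ : Ctx (sheafSig J)}
    (a : ∀ x : Γ.Var, (sheafStructure J F).carrier (Γ.sort x)) {X : C} (R : Sieve X)
    (hR : R ∈ J X) (t : ∀ f : SieveArrow R, Term (sheafSig J) Γ f.1)
    (x : ∀ f : SieveArrow R, F.obj.obj (op f.1))
    (hx : ∀ f, x f ∈ (sheafStructure J F).eval a (t f))
    (y : Term (sheafSig J) Γ X) (b : F.obj.obj (op X))
    (hb : b ∈ (sheafStructure J F).eval a y) :
    (sheafStructure J F).Holds a (amalgamates R hR t y) ↔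
      ∀ f : SieveArrow R, F.obj.map f.2.1.op b = x f := by
  constructor
  · intro h f
    obtain ⟨d, hd, hd'⟩ := h f
    obtain ⟨c, hc, rfl⟩ := (mem_eval_alpha J F a f.2.1 y d).1 hd
    have h₁ := Part.mem_unique hb hc
    subst h₁
    exact Part.mem_unique hd' (hx f)
  · intro h f
    refine ⟨x f, (mem_eval_alpha J F a f.2.1 y _).2 ⟨b, hb, (h f).symm⟩, hx f⟩

/-- The sheaf `F` as a model of the theory of sheaves. -/
def sheafModel : Model (sheafTheory J) where
  toPartialStructure := sheafStructure J F
  satisfies := by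
    rintro q (h : SheafAxiom J q)
    cases h with
    | @alpha_defd X Y f =>
      intro a _
      have hb := (mem_eval_alpha J F a f (theVar J Y) _).2
        ⟨a PUnit.unit, Part.mem_some _, rfl⟩
      exact ⟨_, hb, hb⟩
    | alpha_id X =>
      intro a _
      refine ⟨a PUnit.unit, (mem_eval_alpha J F a (𝟙 X) (theVar J X) _).2
        ⟨a PUnit.unit, Part.mem_some _, ?_⟩, Part.mem_some _⟩
      rw [op_id, F.obj.map_id]
      rfl
    | @alpha_comp X Y Z f g =>
      intro a _
      refine ⟨F.obj.map (f ≫ g).op (a PUnit.unit),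
        (mem_eval_alpha J F a (f ≫ g) (theVar J Z) _).2 ⟨a PUnit.unit, Part.mem_some _, rfl⟩,
        (mem_eval_alpha J F a f _ _).2 ⟨F.obj.map g.op (a PUnit.unit),
          (mem_eval_alpha J F a g _ _).2 ⟨a PUnit.unit, Part.mem_some _, rfl⟩, ?_⟩⟩
      rw [op_comp, F.obj.map_comp]
      rfl
    | @exists_amalgamation X R hR =>
      intro a h
      have hm := (holds_matching J F a R hR (coverVar J R hR) a (fun _ => Part.mem_some _)).1 h
      obtain ⟨y, hy, -⟩ := exists_unique_amalgamation R hR hm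
      have hb := (mem_eval_sigma J F a R hR (coverVar J R hR) y).2
        ⟨a, fun f => Part.mem_some _, hm, hy⟩
      exact (holds_and _ _ _ _).2 ⟨⟨y, hb, hb⟩,
        (holds_amalgamates J F a R hR (coverVar J R hR) a (fun _ => Part.mem_some _) _ y hb).2 hy⟩
    | @unique_amalgamation X R hR =>
      intro a h
      obtain ⟨h₁, h₂⟩ := (holds_and _ _ _ _).1 h
      have hm := (holds_matching J F a R hR (coverVar' J R hR) (fun f => a (Sum.inl f))
        (fun _ => Part.mem_some _)).1 h₁
      have hy := (holds_amalgamates J F a R hR (coverVar' J R hR) (fun f => a (Sum.inl f))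
        (fun _ => Part.mem_some _) (lastVar J R hR) (a (Sum.inr PUnit.unit)) (Part.mem_some _)).1 h₂
      exact ⟨a (Sum.inr PUnit.unit), (mem_eval_sigma J F a R hR _ _).2
        ⟨fun f => a (Sum.inl f), fun f => Part.mem_some _, hm, hy⟩, Part.mem_some _⟩
    | @matching_of_defd X R hR =>
      rintro a ⟨b, hb, -⟩
      obtain ⟨x, hx, hm, -⟩ := (mem_eval_sigma J F a R hR (coverVar J R hR) b).1 hb
      have : x = a := funext fun f => Part.mem_some_iff.1 (hx f)
      subst this
      exact (holds_matching J F x R hR (coverVar J R hR) x (fun _ => Part.mem_some _)).2 hm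

/-- The closed term `α_f(x_X)` over `Σ(F, x_X)`, for a morphism `f : Y ⟶ X`. -/
def alphaIndet {X Y : C} (f : Y ⟶ X) :
    ClosedTerm (indetSig₁ (sheafModel J F).toPartialStructure X) Y :=
  indetApp (S := sheafSig J) (sheafModel J F).toPartialStructure (.alpha f)
    (fun _ => indet₁ (sheafModel J F).toPartialStructure X)

theorem alphaIndet_defd {X Y : C} (f : Y ⟶ X) :
    (indetTheory₁ (sheafTheory J) (sheafModel J F).toPartialStructure X).Proves
      (.defd (alphaIndet J F f)) := by
  let M := (sheafModel J F).toPartialStructure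
  have h₀ : Derivable (indetTheory₁ (sheafTheory J) M X) _ _ :=
    .ax (Or.inl ⟨_, Or.inl (Or.inl ⟨_, SheafAxiom.alpha_defd (J := J) f, rfl⟩), rfl⟩)
  have hx : Derivable (indetTheory₁ (sheafTheory J) M X) .top (.defd (indet₁ M X)) :=
    .ax (Or.inr ⟨PUnit.unit, rfl⟩)
  have h₁ := h₀.subst (Δ := Ctx.empty _) (fun _ => indet₁ M X)
  exact .cut (.and_intro (.conj_intro _ fun _ => hx) (.top_intro _)) h₁

/-- The class `[α_f(x_X)]` in `F⟨x_X⟩_Y`, for a morphism `f : Y ⟶ X`. -/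
def alphaClass {X Y : C} (f : Y ⟶ X) :
    FreeExt (sheafTheory J) (sheafModel J F).toPartialStructure X Y :=
  FreeExt.mk (sheafTheory J) (sheafModel J F).toPartialStructure
    ⟨alphaIndet J F f, alphaIndet_defd J F f⟩

end Sheaves

end PHL

/-! Right to left, `α_ψ` commutes with every `α_f` by naturality of `ψ`. It therefore preserves
matching families and amalgamations, and `α_{ψ⁻¹}` undoes it, so definedness of `σ_R` is reflected.

Left to right, two facts about terms over `Σ(F, x_X)` are combined. The syntactic one
(`locallyGenerated`) is that every provably defined closed term is, on some covering sieve, provably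
a constant `c_a` or of the form `α_g(x)`: the symbols `σ_R` only glue, so they disappear after
restriction. The semantic one is soundness: every sheaf `H` with a morphism `F ⟶ H` and an element
of `H(X)` is a model of `T(F, x_X)`.

The test sheaf is the sheafification of the presheaf coproduct `F + y(X)`, with `x_X` interpreted as
the generic element `𝟙 X`. Since covers are nonempty, the images of `F` and of `y(X)` stay disjoint
(`freeSheafInl_ne_inr`); by subcanonicity `y(X)` embeds (`freeSheafInr_injective`).

For `t` in the isotropy group, the value of `t_X` at the generic element has no restriction in `F`:
values at elements of `F` lie in `F`, so the inverse `r` would carry a morphism into `F`. Only the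
forms `α_g(x)` therefore occur locally, and the morphisms `g` glue to some `ψ_X : X ⟶ X` with `t_X =
α_{ψ_X}(x_X)`. Comparing values at the generic element shows that the `ψ_X` are invertible and
natural. -/

namespace PHL

/-! ### Soundness of partial Horn logic, and values of terms in structures under `M`. -/

section Soundness

variable {S : Signature.{u}}

/-- Instantiation of a derivable sequent at provably defined terms. -/
theorem Derivable.inst {T : Theory S} {Γ Δ : Ctx S} {φ ψ : Horn S Γ} (h : Derivable T φ ψ)
    (σ : ∀ x : Γ.Var, Term S Δ (Γ.sort x)) {χ : Horn S Δ}
    (hσ : ∀ x, Derivable T χ (.defd (σ x))) (hφ : Derivable T χ (φ.subst σ)) :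
    Derivable T χ (ψ.subst σ) :=
  .cut (.and_intro (.conj_intro _ hσ) hφ) (h.subst σ)

theorem Derivable.of_top {T : Theory S} {Γ : Ctx S} {φ χ : Horn S Γ} (h : Derivable T .top φ) :
    Derivable T χ φ :=
  .cut (.top_intro χ) h

/-- Function symbols preserve provable equality, as long as the terms are defined. -/
theorem Derivable.app_congr {T : Theory S} {Γ : Ctx S} {χ : Horn S Γ} {A : S.Srt} (f : S.Fun A)
    {s t : ∀ i : S.Arity f, Term S Γ (S.argSort f i)} (h : ∀ i, Derivable T χ (.eq (s i) (t i)))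
    (hs : Derivable T χ (.defd (.app f s))) : Derivable T χ (.eq (.app f s) (.app f t)) := by
  -- Two copies of the arguments: in `f(x) = f(y)` only the `y` are replaced, which turns `f(s) =
  -- f(s)` into `f(s) = f(t)`.
  let Θ : Ctx S := ⟨S.Arity f ⊕ S.Arity f, by
    rw [← Cardinal.add_def]
    exact Cardinal.add_lt_of_lt S.regular.aleph0_le (S.arity_lt f) (S.arity_lt f),
    Sum.elim (S.argSort f) (S.argSort f)⟩
  let σ : ∀ x : Θ.Var, Term S Γ (Θ.sort x) := fun x => match x with
    | .inl i => s i
    | .inr i => s i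
  let τ : ∀ x : Θ.Var, Term S Γ (Θ.sort x) := fun x => match x with
    | .inl i => s i
    | .inr i => t i
  refine Derivable.leibniz (Γ := Θ) (.eq (.app f fun i => .var (Γ := Θ) (.inl i))
    (.app f fun i => .var (Γ := Θ) (.inr i))) σ τ ?_ hs
  rintro (i | i)
  · exact (h i).cut (.eq_left _ _)
  · exact h i

theorem PartialStructure.eval_subst (M : PartialStructure S) {Γ Δ : Ctx S}
    (a : ∀ x : Δ.Var, M.carrier (Δ.sort x)) (b : ∀ x : Γ.Var, M.carrier (Γ.sort x))
    (σ : ∀ x : Γ.Var, Term S Δ (Γ.sort x)) (h : ∀ x, b x ∈ M.eval a (σ x))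
    {A : S.Srt} (t : Term S Γ A) : M.eval a (t.subst σ) = M.eval b t := by
  induction t with
  | var x => exact Part.eq_some_iff.2 (h x)
  | app f t ih =>
    ext c
    rw [Term.subst, mem_eval_app, mem_eval_app]
    simp only [ih]

theorem PartialStructure.holds_subst (M : PartialStructure S) {Γ Δ : Ctx S}
    (a : ∀ x : Δ.Var, M.carrier (Δ.sort x)) (b : ∀ x : Γ.Var, M.carrier (Γ.sort x))
    (σ : ∀ x : Γ.Var, Term S Δ (Γ.sort x)) (h : ∀ x, b x ∈ M.eval a (σ x))
    (φ : Horn S Γ) : M.Holds a (φ.subst σ) ↔ M.Holds b φ := by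
  induction φ with
  | eq s t => simp only [Horn.subst, Holds, M.eval_subst a b σ h]
  | top => exact Iff.rfl
  | conj I hI φ ih => exact forall_congr' ih

theorem PartialStructure.holds_defd (M : PartialStructure S) {Γ : Ctx S}
    (a : ∀ x : Γ.Var, M.carrier (Γ.sort x)) {A : S.Srt} (t : Term S Γ A) :
    M.Holds a (.defd t) ↔ ∃ b, b ∈ M.eval a t := by
  simp [Horn.defd, Holds]

/-- Soundness of partial Horn logic. -/
theorem Derivable.sound {T : Theory S} {M : PartialStructure S} (hM : ∀ q ∈ T, M.Satisfies q)
    {Γ : Ctx S} {φ ψ : Horn S Γ} (h : Derivable T φ ψ)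
    (a : ∀ x : Γ.Var, M.carrier (Γ.sort x)) (hφ : M.Holds a φ) : M.Holds a ψ := by
  induction h with
  | ax h => exact hM _ h a hφ
  | refl => exact hφ
  | cut _ _ ih₁ ih₂ => exact ih₂ a (ih₁ a hφ)
  | subst σ _ ih =>
    obtain ⟨h₁, h₂⟩ := (holds_and _ _ _ _).1 hφ
    -- The rule requires the substituted terms to be defined; their values form the assignment at
    -- which the induction hypothesis is used.
    choose b hb using fun x => (M.holds_defd a (σ x)).1 (h₁ x)
    exact (M.holds_subst a b σ hb _).2 (ih b ((M.holds_subst a b σ hb _).1 h₂))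
  | top_intro => trivial
  | conj_elim hI φ i => exact hφ i
  | conj_intro hI _ ih => exact fun i => ih i a hφ
  | var_defd x => exact ⟨a x, Part.mem_some _, Part.mem_some _⟩
  | eq_subst φ σ τ =>
    obtain ⟨h₁, h₂⟩ := (holds_and _ _ _ _).1 hφ
    choose b hb hb' using h₁
    exact (M.holds_subst a b τ hb' _).2 ((M.holds_subst a b σ hb _).1 h₂)
  | eq_left => exact ⟨hφ.choose, hφ.choose_spec.1, hφ.choose_spec.1⟩
  | eq_right => exact ⟨hφ.choose, hφ.choose_spec.2, hφ.choose_spec.2⟩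
  | app_strict f t i =>
    obtain ⟨b, hb, -⟩ := hφ
    obtain ⟨x, hx, -⟩ := (mem_eval_app M a f t b).1 hb
    exact ⟨x i, hx i, hx i⟩

/-- The expansion of a structure by an interpretation of new constants. -/
def PartialStructure.expand (M : PartialStructure S) {K : Type u} {s : K → S.Srt}
    (c : ∀ k, M.carrier (s k)) : PartialStructure (S.adjoin s) where
  carrier := M.carrier
  op {A} f := match A, f with
    | _, .old f => M.op f
    | _, .const k => fun _ => Part.some (c k)

section Expand

variable (M : PartialStructure S) {K : Type u} {s : K → S.Srt} (c : ∀ k, M.carrier (s k))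

theorem PartialStructure.eval_lift {Γ : Ctx S} (a : ∀ x : Γ.Var, M.carrier (Γ.sort x))
    {A : S.Srt} (t : Term S Γ A) : (M.expand c).eval (Γ := Γ.lift s) a (t.lift s) = M.eval a t := by
  induction t with
  | var x => rfl
  | app f t ih =>
    ext b
    refine (mem_eval_app (M.expand c) (Γ := Γ.lift s) a (.old f) _ b).trans
      (Iff.trans ?_ (mem_eval_app M a f t b).symm)
    refine exists_congr fun x => and_congr_left fun _ => forall_congr' fun i => ?_
    rw [← ih i]
    rfl

theorem PartialStructure.holds_lift {Γ : Ctx S} (a : ∀ x : Γ.Var, M.carrier (Γ.sort x))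
    (φ : Horn S Γ) : (M.expand c).Holds (Γ := Γ.lift s) a (φ.lift s) ↔ M.Holds a φ := by
  induction φ with
  | eq t₁ t₂ =>
    have h₁ := M.eval_lift c a t₁
    have h₂ := M.eval_lift c a t₂
    simp only [Horn.lift, Holds]
    rw [h₁, h₂]
    rfl
  | top => exact Iff.rfl
  | conj I hI φ ih => exact forall_congr' ih

theorem PartialStructure.mem_eval_constTerm
    (a : ∀ x : (Ctx.empty (S.adjoin s)).Var, M.carrier ((Ctx.empty (S.adjoin s)).sort x))
    (k : K) : c k ∈ (M.expand c).eval a (constTerm s k) :=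
  (mem_eval_app (M.expand c) a _ _ _).2
    ⟨fun i => PEmpty.elim i, fun i => PEmpty.elim i, Part.mem_some _⟩

theorem PartialStructure.expand_satisfies {T : Theory S} (hM : ∀ q ∈ T, M.Satisfies q) :
    ∀ q ∈ T.adjoin s, (M.expand c).Satisfies q := by
  rintro q (⟨q₀, hq₀, rfl⟩ | ⟨k, rfl⟩)
  · intro a h
    exact (M.holds_lift c a _).2 (hM q₀ hq₀ a ((M.holds_lift c a _).1 h))
  · intro a _
    exact ⟨_, M.mem_eval_constTerm c a k, M.mem_eval_constTerm c a k⟩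

end Expand

/-- Homomorphisms preserve the values of terms. -/
theorem PartialStructure.map_mem_eval {M N : PartialStructure S}
    (η : ∀ A : S.Srt, M.carrier A → N.carrier A)
    (hη : ∀ {A : S.Srt} (f : S.Fun A) (x : ∀ i, M.carrier (S.argSort f i)) (b : M.carrier A),
      b ∈ M.op f x → η A b ∈ N.op f (fun i => η _ (x i)))
    {Γ : Ctx S} (a : ∀ x : Γ.Var, M.carrier (Γ.sort x)) {A : S.Srt} (t : Term S Γ A)
    {b : M.carrier A} (h : b ∈ M.eval a t) : η A b ∈ N.eval (fun x => η _ (a x)) t := by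
  induction t with
  | var x =>
    rw [Part.mem_some_iff.1 h]
    exact Part.mem_some _
  | app f t ih =>
    obtain ⟨x, hx, hb⟩ := (mem_eval_app _ _ _ _ _).1 h
    exact (mem_eval_app _ _ _ _ _).2 ⟨_, fun i => ih i (hx i), hη f x b hb⟩

/-- The expansion of `N` to a structure for `Σ(M, (x_i)_i)`, given values of the constants. -/
def underStructure {M : PartialStructure S} (N : PartialStructure S)
    (η : ∀ A : S.Srt, M.carrier A → N.carrier A) {I : Type u} {s : I → S.Srt}
    (c : ∀ i, N.carrier (s i)) : PartialStructure (indetSig M s) :=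
  (N.expand (s := M.eltSort) (fun k => η k.1 k.2)).expand c

/-- The value of a closed term over `Σ(M, (x_i)_i)` in a structure `N` under `M`. -/
def value {M : PartialStructure S} (N : PartialStructure S)
    (η : ∀ A : S.Srt, M.carrier A → N.carrier A) {I : Type u} {s : I → S.Srt}
    (c : ∀ i, N.carrier (s i)) {A : S.Srt} (t : ClosedTerm (indetSig M s) A) :
    Part (N.carrier A) :=
  (underStructure N η c).eval (fun x => PEmpty.elim x) t

section Value

variable {M N : PartialStructure S} (η : ∀ A : S.Srt, M.carrier A → N.carrier A)
  {I : Type u} {s : I → S.Srt} (c : ∀ i, N.carrier (s i))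

theorem mem_value_indet (i : I) : c i ∈ value N η c (indet M s i) :=
  PartialStructure.mem_eval_constTerm (N.expand (s := M.eltSort) (fun k => η k.1 k.2)) c _ i

theorem mem_value_indetApp {A : S.Srt} (f : S.Fun A)
    (t : ∀ i : S.Arity f, ClosedTerm (indetSig M s) (S.argSort f i)) (b : N.carrier A) :
    b ∈ value N η c (indetApp M f t) ↔ ∃ x : ∀ i, N.carrier (S.argSort f i),
      (∀ i, x i ∈ value N η c (t i)) ∧ b ∈ N.op f x :=
  mem_eval_app (underStructure N η c) _ _ _ _

/-- The constant `c_a` over `Σ(M, (x_i)_i)`. -/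
def eltConst (M : PartialStructure S) {I : Type u} (s : I → S.Srt) {A : S.Srt}
    (a : M.carrier A) : ClosedTerm (indetSig M s) A :=
  appOld (S := diagramSig M) (s := s) (AdjoinFun.const (s := M.eltSort) ⟨A, a⟩)
    (fun i => PEmpty.elim i)

theorem mem_value_eltConst {A : S.Srt} (a : M.carrier A) :
    η A a ∈ value N η c (eltConst M s a) :=
  (mem_eval_app (underStructure N η c) _ _ _ _).2
    ⟨fun i => PEmpty.elim i, fun i => PEmpty.elim i, Part.mem_some _⟩

/-- Induction on closed terms over `Σ(M, (x_i)_i)`. -/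
theorem indetTerm_induction {P : ∀ A : S.Srt, ClosedTerm (indetSig M s) A → Prop}
    (elt : ∀ (A : S.Srt) (a : M.carrier A), P A (eltConst M s a))
    (ind : ∀ i, P (s i) (indet M s i))
    (app : ∀ (A : S.Srt) (f : S.Fun A) (t : ∀ i, ClosedTerm (indetSig M s) (S.argSort f i)),
      (∀ i, P _ (t i)) → P A (indetApp M f t))
    {A : S.Srt} (t : ClosedTerm (indetSig M s) A) : P A t := by
  refine Term.rec (S := indetSig M s) (Γ := Ctx.empty _) (motive := fun A t => P A t)
    (fun x => PEmpty.elim x) (fun {A} f t ih => ?_) t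
  match A, f, t, ih with
  | _, .old (.old f), t, ih => exact app _ f t ih
  | _, .old (.const ⟨A, a⟩), t, _ =>
    have : t = fun i => PEmpty.elim i := funext fun i => PEmpty.elim i
    subst this
    exact elt A a
  | _, .const i, t, _ =>
    have : t = fun i => PEmpty.elim i := funext fun i => PEmpty.elim i
    subst this
    exact ind i

/-- This turns the syntactic substitutions in the definition of isotropy into composition of value
functions. The term `r` must have a value, since `x_A` has to be interpreted by an element. -/
theorem value_subst₁ {A B : S.Srt} (t : ClosedTerm (indetSig₁ M A) B)
    (r : ClosedTerm (indetSig M s) A) {b : N.carrier A} (hb : b ∈ value N η c r) :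
    value N η c (subst₁ M t r) = value N η (fun _ => b) t := by
  induction t using indetTerm_induction with
  | elt A a =>
    refine Eq.trans ?_ (Part.eq_some_iff.2 (mem_value_eltConst η (fun _ => b) a)).symm
    refine Eq.trans (congrArg (value N η c) ?_) (Part.eq_some_iff.2 (mem_value_eltConst η c a))
    -- Constants are applied to a function out of `PEmpty`, and two such functions agree only by
    -- extensionality.
    exact congrArg (Term.app (S := indetSig M s)
      (AdjoinFun.old (AdjoinFun.const (s := M.eltSort) ⟨A, a⟩))) (funext fun i => PEmpty.elim i)
  | ind i =>
    exact (Part.eq_some_iff.2 hb).trans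
      (Part.eq_some_iff.2 (mem_value_indet (s := fun _ : PUnit => A) η (fun _ => b) i)).symm
  | app A f t ih =>
    ext d
    refine (mem_value_indetApp η c f _ d).trans
      (Iff.trans ?_ (mem_value_indetApp η _ f t d).symm)
    refine exists_congr fun x => and_congr_left fun _ => forall_congr' fun i => ?_
    rw [← ih i]
    rfl

/-- `η` is a homomorphism of partial structures. -/
structure IsHom (M N : PartialStructure S) (η : ∀ A : S.Srt, M.carrier A → N.carrier A) :
    Prop where
  map_op : ∀ {A : S.Srt} (f : S.Fun A) (x : ∀ i, M.carrier (S.argSort f i)) (b : M.carrier A),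
    b ∈ M.op f x → η A b ∈ N.op f (fun i => η _ (x i))

theorem IsHom.id (M : PartialStructure S) : IsHom M M (fun _ a => a) := ⟨fun _ _ _ h => h⟩

/-- The diagram axioms hold in `N` exactly because `η` carries the graph of each operation of `M`
into that of `N`. -/
theorem IsHom.underStructure_satisfies {T : Theory S} (hN : ∀ q ∈ T, N.Satisfies q) (hη : IsHom M N η) :
    ∀ q ∈ indetTheory T M s, (underStructure N η c).Satisfies q := by
  refine PartialStructure.expand_satisfies (N.expand (s := M.eltSort) (fun k => η k.1 k.2)) c ?_
  rintro q (hq | ⟨A, f, a, b, hb, rfl⟩)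
  · exact PartialStructure.expand_satisfies N _ hN q hq
  · intro e _
    refine ⟨η A b, (mem_eval_app (N.expand _) _ (.old f) _ _).2
      ⟨fun i => η _ (a i), fun i => ?_, hη.map_op f a b hb⟩, ?_⟩
    · exact PartialStructure.mem_eval_constTerm N (s := M.eltSort) (fun k => η k.1 k.2) _
        ⟨_, a i⟩
    · exact PartialStructure.mem_eval_constTerm N (s := M.eltSort) (fun k => η k.1 k.2) _
        ⟨_, b⟩

variable {η}

/-- Equations derivable from a sentence that holds in a structure under `M` hold there. -/
theorem IsHom.value_eq {T : Theory S} (hN : ∀ q ∈ T, N.Satisfies q) (hη : IsHom M N η)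
    {φ : Sentence (indetSig M s)} {B : S.Srt} {t t' : ClosedTerm (indetSig M s) B}
    (h : Derivable (indetTheory T M s) φ (.eq t t'))
    (hφ : (underStructure N η c).Holds (fun x => PEmpty.elim x) φ) :
    ∃ b, b ∈ value N η c t ∧ b ∈ value N η c t' :=
  h.sound (hη.underStructure_satisfies η c hN) _ hφ

/-- With the constants interpreted compatibly, `η` is also a homomorphism of the expanded
structures. -/
theorem IsHom.map_mem_value {η : ∀ A : S.Srt, M.carrier A → N.carrier A} (hη : IsHom M N η)
    (c : ∀ i, M.carrier (s i)) {A : S.Srt} (t : ClosedTerm (indetSig M s) A) {b : M.carrier A}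
    (h : b ∈ value M (fun _ a => a) c t) : η A b ∈ value N η (fun i => η _ (c i)) t := by
  have key := PartialStructure.map_mem_eval (M := underStructure (M := M) M (fun _ a => a) c)
    (N := underStructure N η (fun i => η _ (c i))) η ?_ (fun x => PEmpty.elim x) t h
  · refine Eq.mp (congrArg (fun e => η A b ∈
      (underStructure N η fun i => η (s i) (c i)).eval e t) ?_) key
    exact funext fun x : PEmpty => PEmpty.elim x
  · intro A f x b hb
    match A, f, x, b, hb with
    | _, .old (.old f), x, b, hb => exact hη.map_op f x b hb
    | _, .old (.const k), x, b, hb =>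
      rw [Part.mem_some_iff.1 hb]
      exact Part.mem_some _
    | _, .const i, x, b, hb =>
      rw [Part.mem_some_iff.1 hb]
      exact Part.mem_some _

end Value

end Soundness

/-! ### Derived rules for closed terms in the theory of sheaves. -/

section ClosedTerms

variable {C : Type u} [SmallCategory.{u} C] {J : GrothendieckTopology C}
  {M : PartialStructure (sheafSig J)} {I : Type u} {s : I → C}

/-- The closed term `α_f(t)` over `Σ(M, (x_i)_i)`. -/
noncomputable def alphaTerm {X Y : C} (f : X ⟶ Y) (t : ClosedTerm (indetSig M s) Y) :
    ClosedTerm (indetSig M s) X :=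
  indetApp (S := sheafSig J) M (.alpha f) (fun _ => t)

/-- The closed term `σ_R((t_f)_f)` over `Σ(M, (x_i)_i)`. -/
noncomputable def sigmaTerm {X : C} (R : Sieve X) (hR : R ∈ J X)
    (t : ∀ f : SieveArrow R, ClosedTerm (indetSig M s) f.1) : ClosedTerm (indetSig M s) X :=
  indetApp (S := sheafSig J) M (.sigma R hR) t

/-- Under the hypothesis `χ`, the terms `t_f` provably form a matching family. -/
def ProvMatching (χ : Sentence (indetSig M s)) {X : C} (R : Sieve X)
    (t : ∀ f : SieveArrow R, ClosedTerm (indetSig M s) f.1) : Prop :=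
  ∀ (f : SieveArrow R) (Z : C) (g : Z ⟶ f.1), Derivable (indetTheory (sheafTheory J) M s) χ
    (.eq (alphaTerm g (t f)) (t (f.comp g)))

variable {χ : Sentence (indetSig M s)}

local notation "𝕋" => indetTheory (sheafTheory J) M s

theorem derivable_axiom {q : Sequent (sheafSig J)} (hq : SheafAxiom J q) :
    Derivable 𝕋 ((q.hyp.lift M.eltSort).lift (S := diagramSig M) s)
      ((q.concl.lift M.eltSort).lift (S := diagramSig M) s) :=
  .ax (Or.inl ⟨_, Or.inl (Or.inl ⟨_, hq, rfl⟩), rfl⟩)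

theorem indet_defd (i : I) : Derivable 𝕋 χ (.defd (indet M s i)) :=
  Derivable.of_top (.ax (Or.inr ⟨i, rfl⟩))

theorem alphaTerm_defd {X Y : C} (f : X ⟶ Y) {t : ClosedTerm (indetSig M s) Y}
    (ht : Derivable 𝕋 χ (.defd t)) : Derivable 𝕋 χ (.defd (alphaTerm f t)) :=
  (derivable_axiom (.alpha_defd (J := J) f)).inst (Δ := Ctx.empty _) (fun _ => t) (fun _ => ht)
    (.top_intro _)

theorem defd_of_alphaTerm {X Y : C} (f : X ⟶ Y) {t : ClosedTerm (indetSig M s) Y}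
    (ht : Derivable 𝕋 χ (.defd (alphaTerm f t))) : Derivable 𝕋 χ (.defd t) :=
  ht.cut (.app_strict (S := indetSig M s) (.old (.old (.alpha f))) _ PUnit.unit)

theorem defd_of_sigmaTerm {X : C} {R : Sieve X} (hR : R ∈ J X)
    {t : ∀ f : SieveArrow R, ClosedTerm (indetSig M s) f.1}
    (ht : Derivable 𝕋 χ (.defd (sigmaTerm R hR t))) (f : SieveArrow R) :
    Derivable 𝕋 χ (.defd (t f)) :=
  ht.cut (.app_strict (S := indetSig M s) (.old (.old (.sigma R hR))) _ f)

theorem alphaTerm_id {X : C} {t : ClosedTerm (indetSig M s) X}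
    (ht : Derivable 𝕋 χ (.defd t)) : Derivable 𝕋 χ (.eq (alphaTerm (𝟙 X) t) t) :=
  (derivable_axiom (.alpha_id (J := J) X)).inst (Δ := Ctx.empty _) (fun _ => t) (fun _ => ht)
    (.top_intro _)

theorem alphaTerm_comp {X Y Z : C} (f : X ⟶ Y) (g : Y ⟶ Z) {t : ClosedTerm (indetSig M s) Z}
    (ht : Derivable 𝕋 χ (.defd t)) :
    Derivable 𝕋 χ (.eq (alphaTerm (f ≫ g) t) (alphaTerm f (alphaTerm g t))) :=
  (derivable_axiom (.alpha_comp (J := J) f g)).inst (Δ := Ctx.empty _) (fun _ => t)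
    (fun _ => ht) (.top_intro _)

theorem alphaTerm_congr {X Y : C} (f : X ⟶ Y) {t t' : ClosedTerm (indetSig M s) Y}
    (h : Derivable 𝕋 χ (.eq t t')) : Derivable 𝕋 χ (.eq (alphaTerm f t) (alphaTerm f t')) :=
  .app_congr (S := indetSig M s) (.old (.old (.alpha f))) (fun _ => h)
    (alphaTerm_defd f (h.cut (.eq_left _ _)))

/-- The matching condition at the identity gives `α_id(t_f) ↓`, and function symbols are strict. -/
theorem ProvMatching.defd {X : C} {R : Sieve X}
    {t : ∀ f : SieveArrow R, ClosedTerm (indetSig M s) f.1} (h : ProvMatching χ R t)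
    (f : SieveArrow R) : Derivable 𝕋 χ (.defd (t f)) :=
  defd_of_alphaTerm (𝟙 _) ((h f _ (𝟙 _)).cut (.eq_left _ _))

theorem ProvMatching.sigmaTerm_spec {X : C} {R : Sieve X} (hR : R ∈ J X)
    {t : ∀ f : SieveArrow R, ClosedTerm (indetSig M s) f.1} (h : ProvMatching χ R t) :
    Derivable 𝕋 χ (.defd (sigmaTerm R hR t)) ∧ ∀ f : SieveArrow R,
      Derivable 𝕋 χ (.eq (alphaTerm f.2.1 (sigmaTerm R hR t)) (t f)) := by
  have key := (derivable_axiom (s := s) (M := M) (.exists_amalgamation (J := J) R hR)).inst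
    (Δ := Ctx.empty _) t h.defd
    (.conj_intro _ fun f => .conj_intro _ fun g => h f g.1 g.2)
  have h₁ : Derivable 𝕋 χ (.defd (sigmaTerm R hR t)) :=
    key.cut (.conj_elim (I := ULift Bool) _ _ ⟨true⟩)
  have h₂ : Derivable 𝕋 χ (.conj (SieveArrow R) ((siteCard_spec J).2 X R hR) fun f =>
      .eq (alphaTerm f.2.1 (sigmaTerm R hR t)) (t f)) :=
    key.cut (.conj_elim (I := ULift Bool) _ _ ⟨false⟩)
  exact ⟨h₁, fun f => h₂.cut (.conj_elim _ _ f)⟩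

theorem ProvMatching.sigmaTerm_eq {X : C} {R : Sieve X} (hR : R ∈ J X)
    {t : ∀ f : SieveArrow R, ClosedTerm (indetSig M s) f.1} (h : ProvMatching χ R t)
    {y : ClosedTerm (indetSig M s) X} (hy : Derivable 𝕋 χ (.defd y))
    (hyt : ∀ f : SieveArrow R, Derivable 𝕋 χ (.eq (alphaTerm f.2.1 y) (t f))) :
    Derivable 𝕋 χ (.eq (sigmaTerm R hR t) y) := by
  refine (derivable_axiom (s := s) (M := M) (.unique_amalgamation (J := J) R hR)).inst
    (Δ := Ctx.empty _) (Sum.rec t fun _ => y) ?_ ?_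
  · rintro (f | _)
    · exact h.defd f
    · exact hy
  · refine .conj_intro _ ?_
    rintro ⟨_ | _⟩
    · exact .conj_intro _ hyt
    · exact .conj_intro _ fun f => .conj_intro _ fun g => h f g.1 g.2

theorem ProvMatching.of_defd {X : C} {R : Sieve X} (hR : R ∈ J X)
    {t : ∀ f : SieveArrow R, ClosedTerm (indetSig M s) f.1}
    (h : Derivable 𝕋 χ (.defd (sigmaTerm R hR t))) : ProvMatching χ R t := by
  intro f Z g
  have key := (derivable_axiom (s := s) (M := M) (.matching_of_defd (J := J) R hR)).inst
    (Δ := Ctx.empty _) t (fun f => defd_of_sigmaTerm hR h f) h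
  exact (key.cut (.conj_elim _ _ f)).cut (.conj_elim _ _ (⟨Z, g⟩ : (Z : C) × (Z ⟶ f.1)))

/-- Provable equality is local. -/
theorem eq_of_locally_eq {X : C} {R : Sieve X} (hR : R ∈ J X)
    {t t' : ClosedTerm (indetSig M s) X} (ht : Derivable 𝕋 χ (.defd t))
    (ht' : Derivable 𝕋 χ (.defd t'))
    (h : ∀ f : SieveArrow R, Derivable 𝕋 χ (.eq (alphaTerm f.2.1 t) (alphaTerm f.2.1 t'))) :
    Derivable 𝕋 χ (.eq t t') := by
  -- The restrictions of `t` match, and both `t` and `t'` amalgamate them, so both equal the same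
  -- `σ_R` term.
  have hm : ProvMatching χ R (fun f => alphaTerm f.2.1 t) := fun f Z g =>
    (alphaTerm_comp g f.2.1 ht).symm
  exact (hm.sigmaTerm_eq hR ht fun f => alphaTerm_defd _ ht).symm.trans
    (hm.sigmaTerm_eq hR ht' fun f => (h f).symm)

end ClosedTerms

/-! ### The local form of provably defined terms. -/

section Local

variable {C : Type u} [SmallCategory.{u} C] {J : GrothendieckTopology C}
  {F : Sheaf J (Type u)} {I : Type u} {s : I → C}

theorem alphaTerm_eltConst {χ : Sentence (indetSig (sheafModel J F).toPartialStructure s)}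
    {X Y : C} (f : X ⟶ Y) (a : F.obj.obj (op Y)) :
    Derivable (indetTheory (sheafTheory J) (sheafModel J F).toPartialStructure s) χ
      (.eq (alphaTerm f (eltConst (sheafModel J F).toPartialStructure s a))
        (eltConst (sheafModel J F).toPartialStructure s (F.obj.map f.op a))) := by
  let M := (sheafModel J F).toPartialStructure
  have h : Derivable (indetTheory (sheafTheory J) M s) _ _ :=
    .ax (Or.inl ⟨_, Or.inr ⟨X, .alpha f, fun _ => a, F.obj.map f.op a, Part.mem_some _, rfl⟩,
      rfl⟩)
  have h' := (h.of_top (χ := .top)).inst (Δ := Ctx.empty (indetSig M s)) (χ := χ)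
    (fun x => PEmpty.elim x) (fun x => PEmpty.elim x) (.top_intro _)
  -- Lifting the diagram constant and applying the empty substitution changes only its vacuous
  -- argument family.
  have e : ∀ {Z : C} (b : F.obj.obj (op Z)), eltConst M s b =
      ((eltTerm M b).lift (S := diagramSig M) s).subst (Δ := Ctx.empty (indetSig M s))
        (fun x => PEmpty.elim x) := fun {Z} b =>
    congrArg (Term.app (S := indetSig M s)
      (AdjoinFun.old (AdjoinFun.const (s := M.eltSort) ⟨Z, b⟩))) (funext fun i => PEmpty.elim i)
  change Derivable (indetTheory (sheafTheory J) M s) χ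
    (.eq (alphaTerm f (eltConst M s a)) (eltConst M s (F.obj.map f.op a)))
  rw [e, e]
  exact h'

/-- The closed term `t` is locally a constant `c_a` or of the form `α_g(x_i)`. -/
def LocallyGenerated {X : C}
    (t : ClosedTerm (indetSig (sheafModel J F).toPartialStructure s) X) : Prop :=
  ∃ R ∈ J X, ∀ {Y : C} (f : Y ⟶ X), R f →
    (∃ a : F.obj.obj (op Y),
      (indetTheory (sheafTheory J) (sheafModel J F).toPartialStructure s).Proves
        (.eq (alphaTerm f t) (eltConst (sheafModel J F).toPartialStructure s a))) ∨
    ∃ (i : I) (g : Y ⟶ s i),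
      (indetTheory (sheafTheory J) (sheafModel J F).toPartialStructure s).Proves
        (.eq (alphaTerm f t) (alphaTerm g (indet (sheafModel J F).toPartialStructure s i)))

/-- Induction on terms. Constants and indeterminates need only the maximal sieve; for `α_h` the
cover is pulled back along `h`. On an arrow `f` of `R` the term `σ_R(t)` restricts to `t_f`, which
has its own cover, and these covers compose to a cover of `X`. -/
theorem locallyGenerated {X : C}
    (t : ClosedTerm (indetSig (sheafModel J F).toPartialStructure s) X)
    (ht : (indetTheory (sheafTheory J) (sheafModel J F).toPartialStructure s).Proves (.defd t)) :
    LocallyGenerated t := by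
  refine indetTerm_induction (P := fun X t =>
    (indetTheory (sheafTheory J) (sheafModel J F).toPartialStructure s).Proves (.defd t) →
      LocallyGenerated t) ?_ ?_ ?_ t ht
  · intro X a _
    exact ⟨⊤, J.top_mem X, fun f _ => Or.inl ⟨_, alphaTerm_eltConst f a⟩⟩
  · intro i ht
    exact ⟨⊤, J.top_mem _, fun f _ => Or.inr ⟨i, f, alphaTerm_defd f ht⟩⟩
  · intro X h t ih ht
    cases h with
    | @alpha Y h =>
      have ht' : Theory.Proves _ (.defd (t PUnit.unit)) := defd_of_alphaTerm h ht
      obtain ⟨R, hR, hRt⟩ := ih PUnit.unit ht'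
      refine ⟨R.pullback h, J.pullback_stable h hR, fun f hf => ?_⟩
      have e := (alphaTerm_comp f h ht').symm
      rcases hRt (f ≫ h) hf with ⟨a, ha⟩ | ⟨i, g, hg⟩
      · exact Or.inl ⟨a, e.trans ha⟩
      · exact Or.inr ⟨i, g, e.trans hg⟩
    | sigma R hR =>
      -- Definedness of `σ_R(t)` makes each `t_f` provably defined, as the induction hypothesis
      -- requires.
      have hm : ProvMatching .top R t := .of_defd hR ht
      choose S hS hSt using fun f : SieveArrow R => ih f (hm.defd f)
      refine ⟨Sieve.bind R.arrows fun Y f hf => S ⟨Y, f, hf⟩,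
        J.bind_covering hR fun Y f hf => hS ⟨Y, f, hf⟩, ?_⟩
      rintro Y _ ⟨Z, k, h, hh, hk, rfl⟩
      have e := (alphaTerm_comp k h ht).trans
        (alphaTerm_congr k ((hm.sigmaTerm_spec hR).2 ⟨Z, h, hh⟩))
      rcases hSt ⟨Z, h, hh⟩ k hk with ⟨a, ha⟩ | ⟨i, g, hg⟩
      · exact Or.inl ⟨a, e.trans ha⟩
      · exact Or.inr ⟨i, g, e.trans hg⟩

end Local

/-! ### Automorphisms of the identity functor give elements of the isotropy group. -/

section Automorphisms

variable {C : Type u} [SmallCategory.{u} C] {J : GrothendieckTopology C}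

section

variable {M : PartialStructure (sheafSig J)} {I : Type u} {s : I → C}
  {χ : Sentence (indetSig M s)}

theorem alphaTerm_naturality (ψ : 𝟭 C ⟶ 𝟭 C) {X Y : C} (f : X ⟶ Y)
    {t : ClosedTerm (indetSig M s) Y}
    (ht : Derivable (indetTheory (sheafTheory J) M s) χ (.defd t)) :
    Derivable (indetTheory (sheafTheory J) M s) χ
      (.eq (alphaTerm f (alphaTerm (X := Y) (ψ.app Y) t))
        (alphaTerm (Y := X) (ψ.app X) (alphaTerm f t))) := by
  refine (alphaTerm_comp f (ψ.app Y) ht).symm.trans ?_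
  have e : f ≫ ψ.app Y = ψ.app X ≫ f := ψ.naturality f
  rw [e]
  exact alphaTerm_comp (ψ.app X) f ht

theorem alphaTerm_inv {X Y : C} (f : X ⟶ Y) (g : Y ⟶ X) (h : f ≫ g = 𝟙 X)
    {t : ClosedTerm (indetSig M s) X}
    (ht : Derivable (indetTheory (sheafTheory J) M s) χ (.defd t)) :
    Derivable (indetTheory (sheafTheory J) M s) χ (.eq (alphaTerm f (alphaTerm g t)) t) := by
  refine (alphaTerm_comp f g ht).symm.trans ?_
  rw [h]
  exact alphaTerm_id ht

theorem ProvMatching.map (ψ : 𝟭 C ⟶ 𝟭 C) {X : C} {R : Sieve X}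
    {t : ∀ f : SieveArrow R, ClosedTerm (indetSig M s) f.1} (h : ProvMatching χ R t) :
    ProvMatching χ R (fun f => alphaTerm (X := f.1) (ψ.app f.1) (t f)) := fun f Z g =>
  (alphaTerm_naturality ψ g (h.defd f)).trans (alphaTerm_congr _ (h f Z g))

end

variable (F : Sheaf J (Type u))

theorem alphaClass_mem_logicalIsotropy (ψ : Aut (𝟭 C)) :
    (fun X : C => alphaClass J F (ψ.hom.app X)) ∈
      logicalIsotropy (sheafTheory J) (sheafModel J F) := by
  refine ⟨fun X => ⟨alphaIndet J F (ψ.hom.app X), alphaIndet_defd J F _⟩, rfl, fun X => ?_,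
    fun X h => ?_, fun X h => ?_⟩
  · refine ⟨⟨alphaIndet J F (ψ.inv.app X), alphaIndet_defd J F _⟩, ?_, ?_⟩
    · exact alphaTerm_inv (ψ.hom.app X) (ψ.inv.app X) (ψ.hom_inv_id_app X) (indet_defd PUnit.unit)
    · exact alphaTerm_inv (ψ.inv.app X) (ψ.hom.app X) (ψ.inv_hom_id_app X) (indet_defd PUnit.unit)
  · cases h with
    | @alpha Y f =>
      have hx := fun χ => indet_defd (M := (sheafModel J F).toPartialStructure) (χ := χ)
        (s := SheafFun.argSort J (.alpha f)) PUnit.unit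
      exact (alphaTerm_naturality (Y := Y) ψ.hom f (hx _)).symm
    | sigma R hR =>
      have hm := ProvMatching.of_defd (J := J) hR (.refl (.defd (sigmaTerm R hR
        (indet (sheafModel J F).toPartialStructure (SheafFun.argSort J (.sigma R hR))))))
      obtain ⟨h₁, h₂⟩ := hm.sigmaTerm_spec hR
      -- By naturality, `α_ψ` of the amalgamation amalgamates the family `α_ψ(x_f)`; uniqueness of
      -- amalgamations finishes.
      exact ((hm.map ψ.hom).sigmaTerm_eq hR (alphaTerm_defd (ψ.hom.app X) h₁) fun f =>
        (alphaTerm_naturality ψ.hom f.2.1 h₁).trans (alphaTerm_congr _ (h₂ f))).symm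
  · cases h with
    | @alpha Y f =>
      have hx := fun χ => indet_defd (M := (sheafModel J F).toPartialStructure) (χ := χ)
        (s := SheafFun.argSort J (.alpha f)) PUnit.unit
      exact alphaTerm_defd (Y := Y) f (hx _)
    | sigma R hR =>
      have hm := ProvMatching.of_defd (J := J) hR (.refl (.defd (sigmaTerm R hR fun f =>
        alphaTerm (X := f.1) (Y := f.1) (ψ.hom.app f.1)
          (indet (sheafModel J F).toPartialStructure (SheafFun.argSort J (.sigma R hR)) f))))
      -- Applying `α_{ψ⁻¹}` to the matching family `α_ψ(x_f)` gives back the `x_f` up to provable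
      -- equality, so they match too.
      have hm' := hm.map ψ.inv
      refine (ProvMatching.sigmaTerm_spec hR fun f Z g => ?_).1
      have e := fun f : SieveArrow R => alphaTerm_inv (χ := .defd (sigmaTerm R hR fun f =>
        alphaTerm (X := f.1) (Y := f.1) (ψ.hom.app f.1)
          (indet (sheafModel J F).toPartialStructure (SheafFun.argSort J (.sigma R hR)) f)))
        (ψ.inv.app f.1) (ψ.hom.app f.1) (ψ.inv_hom_id_app f.1)
        (indet_defd (M := (sheafModel J F).toPartialStructure)
          (s := SheafFun.argSort J (.sigma R hR)) f)
      exact ((alphaTerm_congr g (e f)).symm.trans (hm' f Z g)).trans (e (f.comp g))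

end Automorphisms

/-! ### Values of terms in a sheaf under `F`. -/

section SheafValue

variable {C : Type u} [SmallCategory.{u} C] {J : GrothendieckTopology C}

theorem mem_sheafOp_sigma {F : Sheaf J (Type u)} {X : C} (R : Sieve X) (hR : R ∈ J X)
    (x : ∀ f : SieveArrow R, F.obj.obj (op f.1)) (b : F.obj.obj (op X)) :
    b ∈ sheafOp J F (.sigma R hR) x ↔
      IsMatching J F R x ∧ ∀ f : SieveArrow R, F.obj.map f.2.1.op b = x f := by
  constructor
  · rintro ⟨hm, rfl⟩
    exact ⟨hm, (exists_unique_amalgamation R hR hm).choose_spec.1⟩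
  · rintro ⟨hm, hb⟩
    exact ⟨hm, ((exists_unique_amalgamation R hR hm).choose_spec.2 b hb).symm⟩

variable {F H : Sheaf J (Type u)}

/-- The family of maps underlying a morphism of sheaves. -/
noncomputable def homFamily (η : F.obj ⟶ H.obj) (X : C) :
    (sheafModel J F).carrier X → (sheafModel J H).carrier X :=
  fun a => η.app (op X) a

/-- The graph of `σ_R` is described by equations between restrictions, and a natural transformation
preserves these. -/
theorem isHom_homFamily (η : F.obj ⟶ H.obj) :
    IsHom (sheafModel J F).toPartialStructure (sheafModel J H).toPartialStructure
      (homFamily η) := by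
  have nat : ∀ {X Y : C} (f : X ⟶ Y) (a : F.obj.obj (op Y)),
      η.app (op X) (F.obj.map f.op a) = H.obj.map f.op (η.app (op Y) a) := fun f a =>
    NatTrans.naturality_apply η f.op a
  refine ⟨fun {X} h x b hb => ?_⟩
  cases h with
  | @alpha Y f =>
    rw [show b = _ from Part.mem_some_iff.1 hb]
    exact Part.mem_some_iff.2 (nat f _)
  | sigma R hR =>
    obtain ⟨hm, hb⟩ := (mem_sheafOp_sigma R hR x b).1 hb
    refine (mem_sheafOp_sigma R hR (fun f => η.app (op f.1) (x f)) (η.app (op X) b)).2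
      ⟨fun f Z g => ?_, fun f => ?_⟩
    · exact (nat g (x f)).symm.trans (congrArg (η.app (op Z)) (hm f Z g))
    · exact (nat f.2.1 b).symm.trans (congrArg (η.app (op f.1)) (hb f))

/-- The value in `H`, under `F` by `η`, of a closed term over `Σ(F, x_X)` when `x_X` is given
the value `h`. -/
noncomputable def sheafValue (η : F.obj ⟶ H.obj) {X Y : C} (h : H.obj.obj (op X))
    (t : ClosedTerm (indetSig₁ (sheafModel J F).toPartialStructure X) Y) :
    Part (H.obj.obj (op Y)) :=
  value (sheafModel J H).toPartialStructure (homFamily η) (s := fun _ : PUnit => X) (fun _ => h) t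

variable (η : F.obj ⟶ H.obj)

theorem mem_sheafValue_indet {X : C} (h b : H.obj.obj (op X)) :
    b ∈ sheafValue η h (indet₁ (sheafModel J F).toPartialStructure X) ↔ b = h := by
  have := mem_value_indet (N := (sheafModel J H).toPartialStructure) (homFamily η)
    (s := fun _ : PUnit => X) (fun _ => h) PUnit.unit
  exact ⟨fun hb => Part.mem_unique hb this, fun e => e ▸ this⟩

theorem mem_sheafValue_alphaTerm {X Y Z : C} (h : H.obj.obj (op X)) (f : Z ⟶ Y)
    (t : ClosedTerm (indetSig₁ (sheafModel J F).toPartialStructure X) Y)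
    {b : H.obj.obj (op Y)} (hb : b ∈ sheafValue η h t) :
    H.obj.map f.op b ∈ sheafValue η h (alphaTerm f t) :=
  (mem_value_indetApp (N := (sheafModel J H).toPartialStructure) (homFamily η) _ _ _ _).2
    ⟨fun _ => b, fun _ => hb, Part.mem_some _⟩

theorem mem_sheafValue_eltConst {X Y : C} (h : H.obj.obj (op X)) (a : F.obj.obj (op Y)) :
    η.app (op Y) a ∈ sheafValue η h
      (eltConst (sheafModel J F).toPartialStructure (fun _ : PUnit => X) a) :=
  mem_value_eltConst (N := (sheafModel J H).toPartialStructure) (homFamily η) _ a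

theorem sheafValue_eq {X Y : C} (h : H.obj.obj (op X))
    {t t' : ClosedTerm (indetSig₁ (sheafModel J F).toPartialStructure X) Y}
    (e : (indetTheory₁ (sheafTheory J) (sheafModel J F).toPartialStructure X).Proves (.eq t t')) :
    ∃ b, b ∈ sheafValue η h t ∧ b ∈ sheafValue η h t' :=
  (isHom_homFamily η).value_eq _ (sheafModel J H).satisfies e trivial

theorem exists_sheafValue {X Y : C} (h : H.obj.obj (op X))
    {t : ClosedTerm (indetSig₁ (sheafModel J F).toPartialStructure X) Y}
    (ht : (indetTheory₁ (sheafTheory J) (sheafModel J F).toPartialStructure X).Proves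
      (.defd t)) : ∃ b, b ∈ sheafValue η h t := by
  obtain ⟨b, hb, -⟩ := sheafValue_eq η h ht
  exact ⟨b, hb⟩

/-- Provably equal terms have equal values. -/
theorem mem_sheafValue_of_eq {X Y : C} {h : H.obj.obj (op X)}
    {t t' : ClosedTerm (indetSig₁ (sheafModel J F).toPartialStructure X) Y}
    (e : (indetTheory₁ (sheafTheory J) (sheafModel J F).toPartialStructure X).Proves (.eq t t'))
    {b : H.obj.obj (op Y)} (hb : b ∈ sheafValue η h t) : b ∈ sheafValue η h t' := by
  obtain ⟨b', h₁, h₂⟩ := sheafValue_eq η h e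
  rwa [Part.mem_unique hb h₁]

/-- Semantic form of `t[r/x] = x`: the value function of `t` undoes that of `r`, in every sheaf
under `F`. -/
theorem mem_sheafValue_of_subst₁_eq {X : C}
    {t r : ClosedTerm (indetSig₁ (sheafModel J F).toPartialStructure X) X}
    (e : (indetTheory₁ (sheafTheory J) (sheafModel J F).toPartialStructure X).Proves
      (.eq (subst₁ (sheafModel J F).toPartialStructure t r)
        (indet₁ (sheafModel J F).toPartialStructure X)))
    {h b : H.obj.obj (op X)} (hb : b ∈ sheafValue η h r) : h ∈ sheafValue η b t := by
  obtain ⟨b', h₁, h₂⟩ := sheafValue_eq η h e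
  rw [mem_sheafValue_indet] at h₂
  subst h₂
  exact (congrArg (b' ∈ ·) (value_subst₁ (N := (sheafModel J H).toPartialStructure)
    (homFamily η) _ t r hb)).mp h₁

/-- On elements coming from `F`, the value of a term comes from `F`. -/
theorem exists_map_mem_sheafValue {X Y : C}
    {t : ClosedTerm (indetSig₁ (sheafModel J F).toPartialStructure X) Y}
    (ht : (indetTheory₁ (sheafTheory J) (sheafModel J F).toPartialStructure X).Proves
      (.defd t)) (a : F.obj.obj (op X)) :
    ∃ a' : F.obj.obj (op Y), η.app (op Y) a' ∈ sheafValue η (η.app (op X) a) t := by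
  -- The term is evaluated in `F` itself, and its value is then transported along `η`.
  obtain ⟨a', ha'⟩ := exists_sheafValue (𝟙 F.obj) a ht
  exact ⟨a', (isHom_homFamily η).map_mem_value (M := (sheafModel J F).toPartialStructure)
    (s := fun _ : PUnit => X) (fun _ => a) t ha'⟩

/-- Generic commutation with `α_f` makes the value functions of the `t_X` natural with respect to
restriction along `f`. Its hypothesis `α_f(x) ↓` always holds, as `α_f` is total in `H`. -/
theorem CommutesGenerically.map_mem_sheafValue
    {t : ∀ X : C, ClosedTerm (indetSig₁ (sheafModel J F).toPartialStructure X) X} {X Y : C}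
    {f : X ⟶ Y}
    (hf : CommutesGenerically (sheafTheory J) (sheafModel J F).toPartialStructure t
      (SheafFun.alpha f))
    {h b : H.obj.obj (op Y)} (hb : b ∈ sheafValue η h (t Y)) :
    H.obj.map f.op b ∈ sheafValue η (H.obj.map f.op h) (t X) := by
  let M := (sheafModel J F).toPartialStructure
  let N := (sheafModel J H).toPartialStructure
  let s : SheafFun.Arity J (.alpha f) → C := SheafFun.argSort J (.alpha f)
  let c : ∀ i, N.carrier (s i) := fun _ => h
  have hx : h ∈ value N (homFamily η) c (indet M s PUnit.unit) :=
    mem_value_indet (homFamily η) c PUnit.unit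
  have hfx : H.obj.map f.op h ∈ value N (homFamily η) c
      (indetApp (S := sheafSig J) M (.alpha f) (fun i => indet M s i)) :=
    (mem_value_indetApp (N := N) (homFamily η) c _ _ _).2
      ⟨fun _ => h, fun _ => hx, Part.mem_some _⟩
  obtain ⟨d, h₁, h₂⟩ := (isHom_homFamily η).value_eq c (sheafModel J H).satisfies hf
    ⟨_, hfx, hfx⟩
  obtain ⟨y, hy, hd⟩ := (mem_value_indetApp (N := N) (homFamily η) c _ _ _).1 h₂
  have e₁ := value_subst₁ (N := N) (homFamily η) c (t X) _ hfx
  have e₂ := value_subst₁ (N := N) (homFamily η) c (t Y) _ hx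
  have hd' : d = H.obj.map f.op (y PUnit.unit) := Part.mem_some_iff.1 hd
  have hyb : y PUnit.unit = b :=
    Part.mem_unique ((congrArg (y PUnit.unit ∈ ·) e₂).mp (hy PUnit.unit)) hb
  rw [← hyb, ← hd']
  exact (congrArg (d ∈ ·) e₁).mp h₁

end SheafValue

/-! ### The sheaf obtained from `F` by freely adjoining an element, and the reverse inclusion. -/

section FreeSheaf

variable {C : Type u} [SmallCategory.{u} C] {J : GrothendieckTopology C}
  (F : Sheaf J (Type u)) (X : C)

/-- The coproduct of the sheaf `F` and the sheaf associated to the presheaf represented by `X`. -/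
noncomputable def freeSheaf : Sheaf J (Type u) :=
  (presheafToSheaf J (Type u)).obj (FunctorToTypes.coprod F.obj (yoneda.obj X))

/-- The unit, from the presheaf coproduct. -/
noncomputable def freeSheafUnit :
    FunctorToTypes.coprod F.obj (yoneda.obj X) ⟶ (freeSheaf F X).obj :=
  toSheafify J (FunctorToTypes.coprod F.obj (yoneda.obj X))

/-- The inclusion of `F`. -/
noncomputable def freeSheafInl : F.obj ⟶ (freeSheaf F X).obj :=
  FunctorToTypes.coprod.inl ≫ freeSheafUnit F X

variable {F X}

/-- The image of a morphism to `X`. -/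
noncomputable def freeSheafInr {Y : C} (f : Y ⟶ X) : (freeSheaf F X).obj.obj (op Y) :=
  (freeSheafUnit F X).app (op Y)
    (Sum.inr f : F.obj.obj (op Y) ⊕ (yoneda.obj X).obj (op Y))

theorem freeSheaf_map_inr {Y Z : C} (f : Y ⟶ X) (g : Z ⟶ Y) :
    (freeSheaf F X).obj.map g.op (freeSheafInr f) = freeSheafInr (g ≫ f) :=
  (NatTrans.naturality_apply (freeSheafUnit F X) g.op
    (Sum.inr f : F.obj.obj (op Y) ⊕ (yoneda.obj X).obj (op Y))).symm

/-- The unit of sheafification is locally injective. Questions about the free sheaf thus reduce to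
the presheaf coproduct, whose sections are disjoint sums. -/
theorem freeSheafUnit_locally_eq {Y : C} {a b : F.obj.obj (op Y) ⊕ (Y ⟶ X)}
    (h : (freeSheafUnit F X).app (op Y) a = (freeSheafUnit F X).app (op Y) b) :
    ∃ R ∈ J Y, ∀ {Z : C} (g : Z ⟶ Y), R g →
      Sum.map (F.obj.map g.op) (fun f => g ≫ f) a = Sum.map (F.obj.map g.op) (fun f => g ≫ f) b :=
  ⟨Presheaf.equalizerSieve (F := FunctorToTypes.coprod F.obj (yoneda.obj X)) (X := op Y) a b,
    Presheaf.equalizerSieve_mem J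
      (toSheafify J (FunctorToTypes.coprod F.obj (yoneda.obj X))) (X := op Y) a b h,
    fun _ hg => hg⟩

theorem freeSheafInr_injective [J.Subcanonical] {Y : C} {f g : Y ⟶ X}
    (h : (freeSheafInr f : (freeSheaf F X).obj.obj (op Y)) = freeSheafInr g) : f = g := by
  obtain ⟨R, hR, hRfg⟩ := freeSheafUnit_locally_eq h
  have hy : Presieve.IsSheaf J (yoneda.obj X) :=
    GrothendieckTopology.Subcanonical.isSheaf_of_isRepresentable _
  exact (hy R hR).isSeparatedFor.ext fun Z k hk => Sum.inr_injective (hRfg k hk)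

/-- A cover on which the two sections agreed could contain no arrow, since the summands are
disjoint; but no empty sieve covers. -/
theorem freeSheafInl_ne_inr (hJ : ∀ X : C, (⊥ : Sieve X) ∉ J X) {Y : C} (a : F.obj.obj (op Y))
    (f : Y ⟶ X) : (freeSheafInl F X).app (op Y) a ≠ freeSheafInr f := by
  intro h
  obtain ⟨R, hR, hRf⟩ := freeSheafUnit_locally_eq (a := Sum.inl a) (b := Sum.inr f) h
  refine hJ Y (J.superset_covering (fun Z k hk => ?_) hR)
  exact (Sum.inl_ne_inr (hRf k hk)).elim

theorem mem_sheafValue_free {Y : C} (f : Y ⟶ X) :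
    freeSheafInr f ∈ sheafValue (freeSheafInl F X) (freeSheafInr (𝟙 X))
      (alphaTerm f (indet₁ (sheafModel J F).toPartialStructure X)) := by
  have h := mem_sheafValue_alphaTerm (freeSheafInl F X) (freeSheafInr (𝟙 X)) f _
    ((mem_sheafValue_indet (freeSheafInl F X) _ _).2 rfl)
  rwa [freeSheaf_map_inr, Category.comp_id] at h

/-- A term whose value in the free sheaf is nowhere in `F` is provably of the form `α_ψ(x_X)`. -/
theorem exists_eq_alphaTerm [J.Subcanonical] {Y : C}
    {t : ClosedTerm (indetSig₁ (sheafModel J F).toPartialStructure X) Y}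
    (ht : (indetTheory₁ (sheafTheory J) (sheafModel J F).toPartialStructure X).Proves (.defd t))
    {u : (freeSheaf F X).obj.obj (op Y)}
    (hu : u ∈ sheafValue (freeSheafInl F X) (freeSheafInr (𝟙 X)) t)
    (h : ∀ {Z : C} (f : Z ⟶ Y) (a : F.obj.obj (op Z)),
      (freeSheaf F X).obj.map f.op u ≠ (freeSheafInl F X).app (op Z) a) :
    ∃ ψ : Y ⟶ X, (indetTheory₁ (sheafTheory J) (sheafModel J F).toPartialStructure X).Proves
      (.eq t (alphaTerm ψ (indet₁ (sheafModel J F).toPartialStructure X))) := by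
  obtain ⟨R, hR, hRt⟩ := locallyGenerated t ht
  have hg : ∀ f : SieveArrow R, ∃ g : f.1 ⟶ X,
      (indetTheory₁ (sheafTheory J) (sheafModel J F).toPartialStructure X).Proves
        (.eq (alphaTerm f.2.1 t)
          (alphaTerm g (indet₁ (sheafModel J F).toPartialStructure X))) := by
    intro f
    -- A constant `c_a` would put a restriction of `u` in the image of `F`, which `h` excludes.
    rcases hRt f.2.1 f.2.2 with ⟨a, ha⟩ | ⟨_, g, hg⟩
    · refine absurd ?_ (h f.2.1 a)
      exact Part.mem_unique
        (mem_sheafValue_of_eq _ ha (mem_sheafValue_alphaTerm _ _ f.2.1 t hu))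
        (mem_sheafValue_eltConst _ _ a)
    · exact ⟨g, hg⟩
  choose g hg using hg
  have hgu : ∀ f, (freeSheaf F X).obj.map f.2.1.op u = freeSheafInr (g f) := fun f =>
    Part.mem_unique (mem_sheafValue_of_eq _ (hg f) (mem_sheafValue_alphaTerm _ _ f.2.1 t hu))
      (mem_sheafValue_free (g f))
  let fam : Presieve.FamilyOfElements (yoneda.obj X) R.arrows := fun Z f hf => g ⟨Z, f, hf⟩
  have hc : fam.Compatible := by
    refine (Presieve.compatible_iff_sieveCompatible fam).2 fun Z W f k hf => ?_
    -- Compatibility of the `g` can be tested in the free sheaf, where they all become restrictions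
    -- of the one element `u`.
    refine freeSheafInr_injective (F := F) (J := J) ?_
    refine (hgu ⟨W, k ≫ f, R.downward_closed hf k⟩).symm.trans (Eq.trans ?_
      (freeSheaf_map_inr (F := F) (g ⟨Z, f, hf⟩) k))
    rw [← hgu ⟨Z, f, hf⟩]
    simp
  have hy : Presieve.IsSheaf J (yoneda.obj X) :=
    GrothendieckTopology.Subcanonical.isSheaf_of_isRepresentable _
  obtain ⟨ψ, hψ, -⟩ := hy R hR fam hc
  have hx := indet_defd (J := J) (M := (sheafModel J F).toPartialStructure) (χ := .top)
    (s := fun _ : PUnit => X) PUnit.unit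
  refine ⟨ψ, eq_of_locally_eq hR ht (alphaTerm_defd ψ hx) fun f => (hg f).trans ?_⟩
  have e : f.2.1 ≫ ψ = g f := hψ f.2.1 f.2.2
  rw [← e]
  exact alphaTerm_comp f.2.1 ψ hx

theorem mem_sheafValue_iff_of_eq_alphaTerm {H : Sheaf J (Type u)} (η : F.obj ⟶ H.obj) {Y : C}
    {t : ClosedTerm (indetSig₁ (sheafModel J F).toPartialStructure X) Y} {ψ : Y ⟶ X}
    (e : (indetTheory₁ (sheafTheory J) (sheafModel J F).toPartialStructure X).Proves
      (.eq t (alphaTerm ψ (indet₁ (sheafModel J F).toPartialStructure X))))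
    (h : H.obj.obj (op X)) (b : H.obj.obj (op Y)) :
    b ∈ sheafValue η h t ↔ b = H.obj.map ψ.op h := by
  have h₁ := mem_sheafValue_of_eq η e.symm
    (mem_sheafValue_alphaTerm η h ψ _ ((mem_sheafValue_indet η h h).2 rfl))
  exact ⟨fun hb => Part.mem_unique hb h₁, fun hb => hb ▸ h₁⟩

/-- In every sheaf under `F` the value functions of `t` and `r` are mutually inverse, and those of
`t` are natural. Everything else is read off at generic elements of free sheaves. -/
theorem exists_aut_of_mem_logicalIsotropy [J.Subcanonical] (hJ : ∀ X : C, (⊥ : Sieve X) ∉ J X)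
    {x : ∀ X : C, FreeExt (sheafTheory J) (sheafModel J F).toPartialStructure X X}
    (hx : x ∈ logicalIsotropy (sheafTheory J) (sheafModel J F)) :
    ∃ ψ : Aut (𝟭 C), x = fun X : C => alphaClass J F (ψ.hom.app X) := by
  obtain ⟨t, rfl, hinv, hcomm, -⟩ := hx
  choose r hr using hinv
  have htr : ∀ {H : Sheaf J (Type u)} (η : F.obj ⟶ H.obj) {X : C} {h b : H.obj.obj (op X)},
      b ∈ sheafValue η h (r X).1 → h ∈ sheafValue η b (t X).1 := fun {_} η {X} {_} {_} hb =>
    mem_sheafValue_of_subst₁_eq η (hr X).1 hb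
  have hrt : ∀ {H : Sheaf J (Type u)} (η : F.obj ⟶ H.obj) {X : C} {h b : H.obj.obj (op X)},
      b ∈ sheafValue η h (t X).1 → h ∈ sheafValue η b (r X).1 := fun {_} η {X} {_} {_} hb =>
    mem_sheafValue_of_subst₁_eq η (hr X).2 hb
  have hnat : ∀ {H : Sheaf J (Type u)} (η : F.obj ⟶ H.obj) {X Y : C} (f : X ⟶ Y)
      {h b : H.obj.obj (op Y)}, b ∈ sheafValue η h (t Y).1 →
      H.obj.map f.op b ∈ sheafValue η (H.obj.map f.op h) (t X).1 := fun {_} η {X} {_} f {_} {_} hb =>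
    (hcomm X (.alpha f)).map_mem_sheafValue η hb
  have hψ : ∀ X : C, ∃ ψ : X ⟶ X,
      (indetTheory₁ (sheafTheory J) (sheafModel J F).toPartialStructure X).Proves
        (.eq (t X).1 (alphaTerm ψ (indet₁ (sheafModel J F).toPartialStructure X))) := by
    intro X
    obtain ⟨u, hu⟩ := exists_sheafValue (freeSheafInl F X) (freeSheafInr (𝟙 X)) (t X).2
    refine exists_eq_alphaTerm (t X).2 hu fun {Z} f a ha => ?_
    -- If `u` restricts along `f` to `a` in `F`, then `t_Z` has value `a` at the element `f` of
    -- `y(X)`. Hence `r_Z` sends `a` to `f`, whereas its value at `a` comes from `F`.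
    have h₁ := hnat (freeSheafInl F X) f hu
    rw [ha, freeSheaf_map_inr] at h₁
    obtain ⟨a', ha'⟩ := exists_map_mem_sheafValue (freeSheafInl F X) (r Z).2 a
    exact freeSheafInl_ne_inr hJ _ _ (Part.mem_unique ha' (hrt _ h₁))
  have hφ : ∀ X : C, ∃ φ : X ⟶ X,
      (indetTheory₁ (sheafTheory J) (sheafModel J F).toPartialStructure X).Proves
        (.eq (r X).1 (alphaTerm φ (indet₁ (sheafModel J F).toPartialStructure X))) := by
    intro X
    obtain ⟨u, hu⟩ := exists_sheafValue (freeSheafInl F X) (freeSheafInr (𝟙 X)) (r X).2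
    refine exists_eq_alphaTerm (r X).2 hu fun {Z} f a ha => ?_
    -- Naturality is available for `t` only, so the argument runs backwards: `t_X` sends `u` to the
    -- generic element, hence `t_Z` would send `a` to `f`.
    have h₁ := hnat (freeSheafInl F X) f (htr _ hu)
    rw [ha, freeSheaf_map_inr] at h₁
    obtain ⟨a', ha'⟩ := exists_map_mem_sheafValue (freeSheafInl F X) (t Z).2 a
    exact freeSheafInl_ne_inr hJ _ _ (Part.mem_unique ha' h₁)
  choose ψ hψ using hψ
  choose φ hφ using hφ
  have hψφ : ∀ X, ψ X ≫ φ X = 𝟙 X := fun X => by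
    -- At the generic element `r` has value `φ`, and `t` at `φ` has value `ψ ≫ φ` by contravariance
    -- of `α`.
    have h₁ := htr (freeSheafInl F X) ((mem_sheafValue_iff_of_eq_alphaTerm _ (hφ X)
      (freeSheafInr (𝟙 X)) _).2 rfl)
    rw [mem_sheafValue_iff_of_eq_alphaTerm _ (hψ X), freeSheaf_map_inr, freeSheaf_map_inr,
      Category.comp_id] at h₁
    exact (freeSheafInr_injective h₁).symm
  have hφψ : ∀ X, φ X ≫ ψ X = 𝟙 X := fun X => by
    have h₁ := hrt (freeSheafInl F X) ((mem_sheafValue_iff_of_eq_alphaTerm _ (hψ X)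
      (freeSheafInr (𝟙 X)) _).2 rfl)
    rw [mem_sheafValue_iff_of_eq_alphaTerm _ (hφ X), freeSheaf_map_inr, freeSheaf_map_inr,
      Category.comp_id] at h₁
    exact (freeSheafInr_injective h₁).symm
  have hψnat : ∀ {X Y : C} (f : X ⟶ Y), f ≫ ψ Y = ψ X ≫ f := fun {X Y} f => by
    -- The value of `t_X` at the element `f` is `f ≫ ψ Y` by naturality and `ψ X ≫ f` by the formula
    -- for `t_X`.
    have h₁ := hnat (freeSheafInl F Y) f ((mem_sheafValue_iff_of_eq_alphaTerm _ (hψ Y)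
      (freeSheafInr (𝟙 Y)) _).2 rfl)
    rw [mem_sheafValue_iff_of_eq_alphaTerm _ (hψ X)] at h₁
    simp only [freeSheaf_map_inr, Category.comp_id] at h₁
    exact freeSheafInr_injective h₁
  refine ⟨NatIso.ofComponents (fun X => ⟨ψ X, φ X, hψφ X, hφψ X⟩) hψnat, funext fun X => ?_⟩
  exact Quotient.sound (hψ X)

end FreeSheaf

end PHL

theorem proposition3p7 {C : Type u} [SmallCategory.{u} C] (J : GrothendieckTopology C)
    [J.Subcanonical] (hJ : ∀ X : C, (⊥ : Sieve X) ∉ J X) (F : Sheaf J (Type u)) :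
    PHL.logicalIsotropy (PHL.sheafTheory J) (PHL.sheafModel J F) =
      {x | ∃ ψ : Aut (𝟭 C), x = fun X : C => PHL.alphaClass J F (ψ.hom.app X)} := by
  ext x
  constructor
  · exact PHL.exists_aut_of_mem_logicalIsotropy hJ
  · rintro ⟨ψ, rfl⟩
    exact PHL.alphaClass_mem_logicalIsotropy F ψ
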